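/- Let $r\ge 2$ be a fixed integer. An instance of Max $r$-Lin AA is a system of $m$ linear equations over $\mathbb{F}_2$ in $n$ variables $z_1,\dots,z_n$ (equations may be repeated), in which every equation $\sum_{i\in S}z_i=b$ satisfies $1\le |S|\le r$ and carries a positive integral weight, together with a parameter $k\in\mathbb{N}$; the equations are given by listing, for each of them, the indices in $S$, the right-hand side $b$ and the weight. The excess of an assignment $z\in\mathbb{F}_2^n$ is the total weight of satisfied equations minus the total weight of falsified equations, and the question is whether the maximum excess over all assignments is at least $k$. (1) Max $r$-Lin AA has a kernel with $O(k\log k)$ variables: there are functions $f,g,h:\mathbb{N}\to\mathbb{N}$ with $h(k)=O(k\log k)$ as $k\to\infty$ and an algorithm, running in time polynomial in the bit length of the input, that maps every instance $(x,k)$ of Max $r$-Lin AA to an instance $(x',k')$ of Max $r$-Lin AA such that $(x,k)$ is a yes-instance if and only if $(x',k')$ is one, $k'\le f(k)$, the bit length of $x'$ is at most $g(k)$, and $x'$ has at most $h(k)$ variables. (2) Max $r$-Lin AA can be solved in time $2^{O(k\log k)}+m^{O(1)}$: there are a function $h(k)=O(k\log k)$, a constant $d$ and an algorithm that decides every instance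 in time at most $2^{h(k)}+m^{d}$. The constants and functions depend only on $r$. Time is the number of operations of a random access machine with uniform cost, whose arithmetic operations are addition and truncated subtraction of natural numbers. -/

import Mathlib

/-! ### Random access machine with uniform cost

Programs are structured RAM programs. The memory consists of banks of cells that hold natural
numbers; a cell is addressed by a bank (fixed in the program text, so that a program uses finitely
many banks) and a computed address. The arithmetic operations are addition and truncated
subtraction; there is no multiplication, so that a run of `t` steps creates only numbers with
`O(t)` more bits than the input, and polynomial time is the same as for Turing machines. -/

/-- Memory: bank, then address. -/
abbrev RAMState : Type := ℕ → ℕ → ℕ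

/-- Expressions. -/
inductive RAMExpr : Type
  | const (c : ℕ) : RAMExpr
  | get (bank : ℕ) (addr : RAMExpr) : RAMExpr
  | add (e₁ e₂ : RAMExpr) : RAMExpr
  | sub (e₁ e₂ : RAMExpr) : RAMExpr

/-- Value of an expression. -/
def RAMExpr.eval (s : RAMState) : RAMExpr → ℕ
  | const c => c
  | get b a => s b (a.eval s)
  | add e₁ e₂ => e₁.eval s + e₂.eval s
  | sub e₁ e₂ => e₁.eval s - e₂.eval s

/-- Number of operations needed to evaluate an expression. -/
def RAMExpr.cost : RAMExpr → ℕ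
  | const _ => 1
  | get _ a => a.cost + 1
  | add e₁ e₂ => e₁.cost + e₂.cost + 1
  | sub e₁ e₂ => e₁.cost + e₂.cost + 1

/-- Programs. -/
inductive RAMProg : Type
  | skip : RAMProg
  | assign (bank : ℕ) (addr val : RAMExpr) : RAMProg
  | seq (P Q : RAMProg) : RAMProg
  | cond (e : RAMExpr) (P Q : RAMProg) : RAMProg
  | loop (e : RAMExpr) (P : RAMProg) : RAMProg

/-- Writing the value `v` to address `a` of bank `b`. -/
def RAMState.write (s : RAMState) (b a v : ℕ) : RAMState :=
  Function.update s b (Function.update (s b) a v)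

/-- `RAMExec P s t s'`: started in `s`, the program `P` halts in `s'` after exactly `t` operations.
`cond e P Q` runs `P` if `e ≠ 0` and `Q` otherwise; `loop e P` repeats `P` while `e ≠ 0`. -/
inductive RAMExec : RAMProg → RAMState → ℕ → RAMState → Prop
  | skip (s : RAMState) : RAMExec .skip s 1 s
  | assign (b : ℕ) (a e : RAMExpr) (s : RAMState) :
      RAMExec (.assign b a e) s (a.cost + e.cost + 1) (s.write b (a.eval s) (e.eval s))
  | seq {P Q : RAMProg} {s s' s'' : RAMState} {t t' : ℕ} :
      RAMExec P s t s' → RAMExec Q s' t' s'' → RAMExec (.seq P Q) s (t + t') s''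
  | cond_true {e : RAMExpr} {P Q : RAMProg} {s s' : RAMState} {t : ℕ} :
      e.eval s ≠ 0 → RAMExec P s t s' → RAMExec (.cond e P Q) s (e.cost + 1 + t) s'
  | cond_false {e : RAMExpr} {P Q : RAMProg} {s s' : RAMState} {t : ℕ} :
      e.eval s = 0 → RAMExec Q s t s' → RAMExec (.cond e P Q) s (e.cost + 1 + t) s'
  | loop_done {e : RAMExpr} {P : RAMProg} {s : RAMState} :
      e.eval s = 0 → RAMExec (.loop e P) s (e.cost + 1) s
  | loop_step {e : RAMExpr} {P : RAMProg} {s s' s'' : RAMState} {t t' : ℕ} :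
      e.eval s ≠ 0 → RAMExec P s t s' → RAMExec (.loop e P) s' t' s'' →
        RAMExec (.loop e P) s (e.cost + 1 + t + t') s''

/-- Runs are deterministic: the running time and the final memory are determined. -/
theorem RAMExec.deterministic {P : RAMProg} {s s₁ s₂ : RAMState} {t₁ t₂ : ℕ}
    (h₁ : RAMExec P s t₁ s₁) (h₂ : RAMExec P s t₂ s₂) : t₁ = t₂ ∧ s₁ = s₂ := by
  induction h₁ generalizing t₂ s₂ with
  | skip s => cases h₂; exact ⟨rfl, rfl⟩
  | assign b a e s => cases h₂; exact ⟨rfl, rfl⟩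
  | seq _ _ ih ih' =>
    cases h₂ with
    | seq h h' =>
      obtain ⟨rfl, rfl⟩ := ih h
      obtain ⟨rfl, rfl⟩ := ih' h'
      exact ⟨rfl, rfl⟩
  | cond_true he _ ih =>
    cases h₂ with
    | cond_true _ h => obtain ⟨rfl, rfl⟩ := ih h; exact ⟨rfl, rfl⟩
    | cond_false he' _ => exact absurd he' he
  | cond_false he _ ih =>
    cases h₂ with
    | cond_true he' _ => exact absurd he he'
    | cond_false _ h => obtain ⟨rfl, rfl⟩ := ih h; exact ⟨rfl, rfl⟩
  | loop_done he =>
    cases h₂ with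
    | loop_done _ => exact ⟨rfl, rfl⟩
    | loop_step he' _ _ => exact absurd he he'
  | loop_step he _ _ ih ih' =>
    cases h₂ with
    | loop_done he' => exact absurd he' he
    | loop_step _ h h' =>
      obtain ⟨rfl, rfl⟩ := ih h
      obtain ⟨rfl, rfl⟩ := ih' h'
      exact ⟨rfl, rfl⟩

/-- Initial memory: bank `0` holds the length of the input followed by the input; all other cells
are `0`. -/
def RAMState.init (l : List ℕ) : RAMState := fun b a =>
  if b = 0 then (l.length :: l).getD a 0 else 0

/-- Bank `1` holds the length of the list `l` followed by `l`. -/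
def RAMState.HasOutput (s : RAMState) (l : List ℕ) : Prop :=
  ∀ (i : ℕ) (h : i < (l.length :: l).length), s 1 i = (l.length :: l)[i]

/-- On the given input, the program halts with the given output after at most `T` operations. -/
def RAMProg.OutputsInTime (P : RAMProg) (input output : List ℕ) (T : ℕ) : Prop :=
  ∃ (t : ℕ) (s : RAMState), t ≤ T ∧ RAMExec P (RAMState.init input) t s ∧ s.HasOutput output

/-! ### Parameterized problems and kernels -/

/-- Number of bits of a list of natural numbers written in binary, with one separator for each. -/
def bitLength (l : List ℕ) : ℕ := (l.map fun a => Nat.size a + 1).sum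

/-- A parameterized problem: instances, their encoding, and the pairs `(x, k)` with answer yes. -/
structure ParamProblem where
  Instance : Type
  encode : Instance → List ℕ
  Yes : Instance → ℕ → Prop

/-- The problem has a kernel in which the quantity `ν` is at most `h k`: there is a polynomial-time
algorithm that maps each `(x, k)` to an equivalent `(x', k')` with `k' ≤ f k`, `|x'| ≤ g k` and
`ν x' ≤ h k`. -/
def ParamProblem.HasKernelWith (L : ParamProblem) (ν : L.Instance → ℕ) (h : ℕ → ℕ) : Prop :=
  ∃ (P : RAMProg) (p : Polynomial ℕ) (f g : ℕ → ℕ), ∀ (x : L.Instance) (k : ℕ),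
    ∃ (x' : L.Instance) (k' : ℕ),
      P.OutputsInTime (k :: L.encode x) (k' :: L.encode x')
        (p.eval (bitLength (k :: L.encode x))) ∧
      (L.Yes x k ↔ L.Yes x' k') ∧ k' ≤ f k ∧ bitLength (L.encode x') ≤ g k ∧ ν x' ≤ h k

/-- Some program decides every `(x, k)` in at most `T x k` operations, answering `1` or `0`. -/
def ParamProblem.SolvableInTime (L : ParamProblem) (T : L.Instance → ℕ → ℕ) : Prop :=
  ∃ P : RAMProg, ∀ (x : L.Instance) (k : ℕ),
    (L.Yes x k → P.OutputsInTime (k :: L.encode x) [1] (T x k)) ∧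
    (¬ L.Yes x k → P.OutputsInTime (k :: L.encode x) [0] (T x k))

/-! ### Max r-Lin above average -/

/-- A weighted equation `∑ i ∈ S, z i = b` over `𝔽₂` in the variables `z 0, …, z (n - 1)`, with
at least one and at most `r` variables and a positive integral weight. -/
structure WeightedEq (r n : ℕ) where
  S : Finset (Fin n)
  b : ZMod 2
  w : ℕ
  nonempty : S.Nonempty
  card_le : S.card ≤ r
  w_pos : 0 < w

/-- The assignment `z` satisfies the equation. -/
def WeightedEq.Sat {r n : ℕ} (e : WeightedEq r n) (z : Fin n → ZMod 2) : Prop :=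
  ∑ i ∈ e.S, z i = e.b

instance {r n : ℕ} (e : WeightedEq r n) (z : Fin n → ZMod 2) : Decidable (e.Sat z) :=
  inferInstanceAs (Decidable (_ = _))

/-- A system of weighted equations (possibly with repetitions) in `n` variables, each equation
having at most `r` variables. -/
structure RLinSystem (r : ℕ) where
  n : ℕ
  eqs : List (WeightedEq r n)

namespace RLinSystem

/-- Number of equations. -/
def m {r : ℕ} (I : RLinSystem r) : ℕ := I.eqs.length

/-- Total weight of satisfied equations minus total weight of falsified equations. -/
def excess {r : ℕ} (I : RLinSystem r) (z : Fin I.n → ZMod 2) : ℤ :=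
  ((I.eqs.filter fun e => e.Sat z).map fun e => (e.w : ℤ)).sum -
    ((I.eqs.filter fun e => ¬ e.Sat z).map fun e => (e.w : ℤ)).sum

/-- Maximum excess over all assignments. -/
def maxExcess {r : ℕ} (I : RLinSystem r) : ℤ :=
  (Finset.univ : Finset (Fin I.n → ZMod 2)).sup' ⟨0, Finset.mem_univ 0⟩ I.excess

/-- Encoding: `n`, `m`, and for every equation the number of its variables, the increasing list
of the indices of its variables, its right-hand side and its weight. -/
def encode {r : ℕ} (I : RLinSystem r) : List ℕ :=
  I.n :: I.m :: I.eqs.flatMap fun e =>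
    e.S.card :: ((e.S.sort (· ≤ ·)).map fun i => (i : ℕ)) ++ [e.b.val, e.w]

end RLinSystem

/-- Max r-Lin AA: is the maximum excess at least the parameter `k`? -/
def maxRLinAA (r : ℕ) : ParamProblem where
  Instance := RLinSystem r
  encode := RLinSystem.encode
  Yes I k := (k : ℤ) ≤ I.maxExcess

/-!
Equations with the same variables are merged; let `c u` be the signed weight of the merged equation
with variable set `u`, and call a variable essential if it occurs in some `u` with `c u ≠ 0`. If
some `|c u| ≥ k`, or if there are at least `2 * r * k` essential variables, the answer is yes;
otherwise the merged equations form the kernel, and trying all values of the fewer than `2 * r * k`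
essential variables decides the instance.

Let `M` be the set of all `u` with `c u ≠ 0`, as vectors over `𝔽₂`. A random subset sum of `M` is
nonzero at each essential variable with probability `1 / 2`, so some subset sum is nonzero at
`r * k` of them. A minimal `K ⊆ M` with that sum has at least `k` elements, each having at most `r`
variables, and is sum-free in `M`: no nonempty part of `K` sums to `0`, and none with at least two
elements sums into `M`. Hence, averaged against the nonnegative Riesz product
`∏ u ∈ K, (1 + sign (c u) * χ u)`, which has mean `1`, the excess is `∑ u ∈ K, |c u| ≥ k`.
-/

/-! ### Walsh characters and Riesz products -/

section SumFree

variable {G : Type*} [AddCommGroup G]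

/-- No nonempty part of `K` sums to `0`, and no part of at least two elements sums into `M`. This is
what makes the Riesz product over `K` orthogonal to every character from `M` outside `K`. -/
structure IsSumFreeIn (K : Finset G) (M : Set G) : Prop where
  sum_ne_zero : ∀ I ⊆ K, I.Nonempty → ∑ u ∈ I, u ≠ 0
  sum_notMem : ∀ I ⊆ K, 2 ≤ I.card → ∑ u ∈ I, u ∉ M

theorem isSumFreeIn_singleton {u : G} (hu : u ≠ 0) (M : Set G) : IsSumFreeIn {u} M where
  sum_ne_zero I hI hne := by simpa [(Finset.subset_singleton_iff.1 hI).resolve_left hne.ne_empty]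
  sum_notMem I hI h2 := by
    have := Finset.card_le_card hI
    rw [Finset.card_singleton] at this
    omega

theorem exists_isSumFreeIn [Module (ZMod 2) G] {M : Set G} {J : Finset G} (hJ : ↑J ⊆ M) :
    ∃ K : Finset G, ↑K ⊆ M ∧ ∑ u ∈ K, u = ∑ u ∈ J, u ∧ IsSumFreeIn K M := by
  classical
  obtain ⟨K, ⟨hKM, hKJ⟩, hK⟩ := exists_minimalFor_of_wellFoundedLT
    (fun K : Finset G => ↑K ⊆ M ∧ ∑ u ∈ K, u = ∑ u ∈ J, u) Finset.card ⟨J, hJ, rfl⟩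
  have min {L : Finset G} (hL : ↑L ⊆ M) (hs : ∑ u ∈ L, u = ∑ u ∈ K, u) : K.card ≤ L.card := by
    by_contra! hlt
    exact hlt.not_ge (hK ⟨hL, hs.trans hKJ⟩ hlt.le)
  have sdiff_subset (I : Finset G) : ↑(K \ I) ⊆ M :=
    (Finset.coe_subset.2 Finset.sdiff_subset).trans hKM
  refine ⟨K, hKM, hKJ, fun I hI hne h0 => ?_, fun I hI h2 hmem => ?_⟩
  · have hle := min (sdiff_subset I) (by rw [← Finset.sum_sdiff hI, h0, add_zero])
    have := Finset.card_sdiff_add_card_eq_card hI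
    have := hne.card_pos
    omega
  · -- `I` can be replaced by its sum, which is added to or cancelled from the rest of `K`.
    have hcard := Finset.card_sdiff_add_card_eq_card hI
    have hsum := Finset.sum_sdiff hI (f := id)
    simp only [id] at hsum
    by_cases hu : ∑ u ∈ I, u ∈ K \ I
    · have hle := min (L := (K \ I).erase (∑ u ∈ I, u))
        ((Finset.coe_subset.2 (Finset.erase_subset _ _)).trans (sdiff_subset I)) (by
          rw [← hsum, ← Finset.sum_erase_add _ _ hu, add_assoc, ZModModule.add_self, add_zero])
      have := Finset.card_erase_le (s := K \ I) (a := ∑ u ∈ I, u)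
      omega
    · have hle := min (L := insert (∑ u ∈ I, u) (K \ I))
        (by rw [Finset.coe_insert]; exact Set.insert_subset hmem (sdiff_subset I))
        (by rw [Finset.sum_insert hu, add_comm, hsum])
      rw [Finset.card_insert_of_notMem hu] at hle
      omega

end SumFree

section Walsh

theorem uzpow_sum {ι : Type*} (y : ℤˣ) (s : Finset ι) (f : ι → ZMod 2) :
    y ^ ∑ j ∈ s, f j = ∏ j ∈ s, y ^ f j := by
  classical
  induction s using Finset.induction_on with
  | empty => simp
  | insert j s hj ih => rw [Finset.sum_insert hj, Finset.prod_insert hj, uzpow_add, ih]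

variable {V : Type*} [Fintype V]

/-- The Walsh character of index `u` on `{1, -1}ⱽ`: the product of the `x i` with `u i = 1`. -/
def walsh (u : V → ZMod 2) (x : V → ℤˣ) : ℤˣ := ∏ i, x i ^ u i

theorem walsh_zero (x : V → ℤˣ) : walsh 0 x = 1 := by simp [walsh]

theorem walsh_add (u v : V → ZMod 2) (x : V → ℤˣ) : walsh (u + v) x = walsh u x * walsh v x := by
  simp [walsh, uzpow_add, Finset.prod_mul_distrib]

theorem walsh_sum {ι : Type*} (s : Finset ι) (f : ι → V → ZMod 2) (x : V → ℤˣ) :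
    walsh (∑ j ∈ s, f j) x = ∏ j ∈ s, walsh (f j) x := by
  simp only [walsh, Finset.sum_apply, uzpow_sum]
  exact Finset.prod_comm

/-- The Riesz product of the characters from `K` with the signs `ε`, a density for a random `x` that
is biased towards `walsh u x = ε u` for all `u ∈ K`. -/
def rieszProd (ε : (V → ZMod 2) → ℤ) (K : Finset (V → ZMod 2)) (x : V → ℤˣ) : ℤ :=
  ∏ u ∈ K, (1 + ε u * walsh u x)

variable {c ε : (V → ZMod 2) → ℤ} {K : Finset (V → ZMod 2)} {M : Set (V → ZMod 2)}

theorem rieszProd_nonneg (hε : ∀ u, |ε u| ≤ 1) (x : V → ℤˣ) : 0 ≤ rieszProd ε K x := by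
  refine Finset.prod_nonneg fun u _ => ?_
  have := abs_le.1 (hε u)
  rcases Int.units_eq_one_or (walsh u x) with h | h <;> simp only [h, Units.val_one, Units.val_neg]
    <;> linarith

theorem rieszProd_eq_sum (ε : (V → ZMod 2) → ℤ) (K : Finset (V → ZMod 2)) (x : V → ℤˣ) :
    rieszProd ε K x = ∑ I ∈ K.powerset, (∏ u ∈ I, ε u) * walsh (∑ u ∈ I, u) x := by
  simp only [rieszProd, Finset.prod_one_add, Finset.prod_mul_distrib, walsh_sum, Units.coe_prod]

variable [DecidableEq V]

/-- The polynomial in variables from `{1, -1}` that has the coefficients `c`. -/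
def walshSum (c : (V → ZMod 2) → ℤ) (x : V → ℤˣ) : ℤ := ∑ u, c u * walsh u x

theorem sum_walsh (u : V → ZMod 2) :
    ∑ x : V → ℤˣ, (walsh u x : ℤ) = if u = 0 then 2 ^ Fintype.card V else 0 := by
  have hsum (a : ZMod 2) : ∑ y : ℤˣ, ((y ^ a : ℤˣ) : ℤ) = if a = 0 then 2 else 0 := by
    revert a; decide
  have hprod : ∑ x : V → ℤˣ, (walsh u x : ℤ) = ∏ i, ∑ y : ℤˣ, ((y ^ u i : ℤˣ) : ℤ) := by
    simp only [walsh, Units.coe_prod, Finset.prod_univ_sum, Fintype.piFinset_univ]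
  simp only [hprod, hsum]
  split_ifs with h
  · simp [h]
  · obtain ⟨i, hi⟩ := Function.ne_iff.1 h
    exact Finset.prod_eq_zero (Finset.mem_univ i) (if_neg hi)

theorem sum_walsh_mul_walsh (u v : V → ZMod 2) :
    ∑ x : V → ℤˣ, (walsh u x * walsh v x : ℤ) = if u = v then 2 ^ Fintype.card V else 0 := by
  simp only [← Units.val_mul, ← walsh_add, sum_walsh, ← ZModModule.sub_eq_add u v, sub_eq_zero]

theorem sum_walsh_mul_rieszProd (u : V → ZMod 2) :
    ∑ x : V → ℤˣ, walsh u x * rieszProd ε K x =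
      2 ^ Fintype.card V * ∑ I ∈ K.powerset with u = ∑ v ∈ I, v, ∏ v ∈ I, ε v := by
  simp only [rieszProd_eq_sum, Finset.mul_sum]
  rw [Finset.sum_comm, Finset.sum_filter]
  refine Finset.sum_congr rfl fun I _ => ?_
  simp only [mul_left_comm _ (∏ v ∈ I, ε v), ← Finset.mul_sum, sum_walsh_mul_walsh]
  split_ifs <;> ring

namespace IsSumFreeIn

theorem sum_rieszProd (hK : IsSumFreeIn K M) :
    ∑ x : V → ℤˣ, rieszProd ε K x = 2 ^ Fintype.card V := by
  have hfilter : (K.powerset.filter fun I => 0 = ∑ v ∈ I, v) = {∅} := by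
    ext I
    rw [Finset.mem_filter, Finset.mem_powerset, Finset.mem_singleton]
    refine ⟨fun ⟨hI, h0⟩ => ?_, by rintro rfl; simp⟩
    by_contra hne
    exact hK.sum_ne_zero I hI (Finset.nonempty_iff_ne_empty.2 hne) h0.symm
  simpa [walsh_zero, hfilter] using sum_walsh_mul_rieszProd (ε := ε) (K := K) 0

theorem sum_walsh_mul_rieszProd (hK : IsSumFreeIn K M) {u : V → ZMod 2} (hu : u ∈ M)
    (hu0 : u ≠ 0) :
    ∑ x : V → ℤˣ, walsh u x * rieszProd ε K x =
      2 ^ Fintype.card V * if u ∈ K then ε u else 0 := by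
  have hfilter : (K.powerset.filter fun I => u = ∑ v ∈ I, v) = if u ∈ K then {{u}} else ∅ := by
    ext I
    rw [Finset.mem_filter, Finset.mem_powerset]
    constructor
    · rintro ⟨hI, rfl⟩
      have hle : I.card ≤ 1 := not_lt.1 fun h => hK.sum_notMem I hI h hu
      obtain rfl | ⟨v, rfl⟩ := (Nat.le_one_iff_eq_zero_or_eq_one.1 hle).imp Finset.card_eq_zero.1
        Finset.card_eq_one.1
      · simp at hu0
      · simp [show v ∈ K by simpa using hI]
    · split_ifs with huK <;> simp +contextual [huK]
  rw [_root_.sum_walsh_mul_rieszProd, hfilter]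
  split_ifs <;> simp

theorem sum_walshSum_mul_rieszProd (hc : c 0 = 0) (hK : IsSumFreeIn K c.support) :
    ∑ x : V → ℤˣ, walshSum c x * rieszProd ε K x =
      2 ^ Fintype.card V * ∑ u ∈ K, ε u * c u := by
  have hterm (u : V → ZMod 2) : c u * ∑ x : V → ℤˣ, walsh u x * rieszProd ε K x =
      2 ^ Fintype.card V * if u ∈ K then ε u * c u else 0 := by
    by_cases hu : c u = 0
    · simp [hu]
    · rw [hK.sum_walsh_mul_rieszProd hu (by rintro rfl; exact hu hc)]
      split_ifs <;> ring
  simp only [walshSum, Finset.sum_mul, mul_assoc]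
  rw [Finset.sum_comm]
  simp only [← Finset.mul_sum, hterm, Finset.sum_ite_mem, Finset.univ_inter]

theorem exists_sum_abs_le (hc : c 0 = 0) (hK : IsSumFreeIn K c.support) :
    ∃ x, ∑ u ∈ K, |c u| ≤ walshSum c x := by
  let ε u := (c u).sign
  have hε (u) : |ε u| ≤ 1 := by
    rcases lt_trichotomy (c u) 0 with h | h | h <;> simp [ε, h, Int.sign_eq_neg_one_of_neg,
      Int.sign_eq_one_of_pos]
  have hmean := hK.sum_walshSum_mul_rieszProd (ε := ε) hc
  simp only [ε, Int.sign_mul_self_eq_abs] at hmean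
  by_contra! hlt
  have hle : ∑ x, walshSum c x * rieszProd ε K x ≤
      ∑ x, (∑ u ∈ K, |c u| - 1) * rieszProd ε K x :=
    Finset.sum_le_sum fun x _ =>
      mul_le_mul_of_nonneg_right (Int.le_sub_one_of_lt (hlt x)) (rieszProd_nonneg hε x)
  rw [hmean, ← Finset.mul_sum, hK.sum_rieszProd] at hle
  have : (0 : ℤ) < 2 ^ Fintype.card V := by positivity
  linarith

end IsSumFreeIn

theorem exists_abs_coeff_le_walshSum (hc : c 0 = 0) (u : V → ZMod 2) :
    ∃ x, |c u| ≤ walshSum c x := by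
  by_cases hu : u = 0
  · have hempty : IsSumFreeIn ∅ c.support := ⟨by simp, by simp +contextual⟩
    simpa [hu, hc] using hempty.exists_sum_abs_le hc
  · simpa using (isSumFreeIn_singleton hu c.support).exists_sum_abs_le hc

end Walsh

/-! ### Random subset sums -/

theorem two_mul_card_filter_powerset_sum_ne_zero {ι : Type*} {M : Finset ι} {f : ι → ZMod 2}
    {a : ι} (ha : a ∈ M) (hfa : f a ≠ 0) :
    2 * (M.powerset.filter fun J => ∑ j ∈ J, f j ≠ 0).card = 2 ^ M.card := by
  classical
  rw [← Finset.insert_erase ha, Finset.card_filter,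
    Finset.sum_powerset_insert (Finset.notMem_erase a M), ← Finset.sum_add_distrib,
    Finset.card_insert_of_notMem (Finset.notMem_erase a M), pow_succ', ← Finset.card_powerset,
    Finset.card_eq_sum_ones]
  congr 1
  refine Finset.sum_congr rfl fun J hJ => ?_
  rw [Finset.sum_insert fun h => Finset.notMem_erase a M (Finset.mem_powerset.1 hJ h)]
  have toggle : ∀ x y : ZMod 2, x ≠ 0 →
      ((if y ≠ 0 then 1 else 0) + if x + y ≠ 0 then 1 else 0) = 1 := by decide
  exact toggle _ _ hfa

section Cover

variable {V : Type*} [Fintype V] {r k : ℕ}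

theorem hammingNorm_sum_le {ι G : Type*} [AddCommGroup G] [DecidableEq G] (s : Finset ι)
    (f : ι → V → G) : hammingNorm (∑ j ∈ s, f j) ≤ ∑ j ∈ s, hammingNorm (f j) :=
  Finset.le_sum_of_subadditive _ hammingNorm_zero.le (fun u v => by
    simpa [hammingDist_eq_hammingNorm] using hammingDist_triangle (-u) 0 v) s f

theorem exists_subset_card_le_two_mul_hammingNorm {M : Finset (V → ZMod 2)} {U : Finset V}
    (hU : ∀ i ∈ U, ∃ u ∈ M, u i ≠ 0) :
    ∃ J ⊆ M, U.card ≤ 2 * hammingNorm (∑ u ∈ J, u) := by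
  classical
  have hcount : ∑ _ ∈ M.powerset, U.card ≤
      ∑ J ∈ M.powerset, 2 * (U.filter fun i => (∑ u ∈ J, u) i ≠ 0).card := by
    calc ∑ _ ∈ M.powerset, U.card = ∑ _ ∈ U, 2 ^ M.card := by
          simp only [Finset.sum_const, Finset.card_powerset, smul_eq_mul, mul_comm]
      _ ≤ ∑ i ∈ U, 2 * (M.powerset.filter fun J => (∑ u ∈ J, u) i ≠ 0).card := by
          refine Finset.sum_le_sum fun i hi => ?_
          obtain ⟨u, hu, hui⟩ := hU i hi
          simpa only [Finset.sum_apply] using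
            (two_mul_card_filter_powerset_sum_ne_zero (f := fun v => v i) hu hui).ge
      _ = ∑ J ∈ M.powerset, 2 * (U.filter fun i => (∑ u ∈ J, u) i ≠ 0).card := by
          simp only [← Finset.mul_sum]
          congr 1
          exact (Finset.sum_card_bipartiteAbove_eq_sum_card_bipartiteBelow
            fun (J : Finset (V → ZMod 2)) i => (∑ u ∈ J, u) i ≠ 0).symm
  obtain ⟨J, hJ, hle⟩ := Finset.exists_le_of_sum_le ⟨∅, Finset.empty_mem_powerset M⟩ hcount
  exact ⟨J, Finset.mem_powerset.1 hJ, hle.trans <|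
    Nat.mul_le_mul_left 2 (Finset.card_le_card (Finset.filter_subset_filter _ U.subset_univ))⟩

theorem exists_isSumFreeIn_card_ge {M : Set (V → ZMod 2)} (hr : 0 < r)
    (hM : ∀ u ∈ M, hammingNorm u ≤ r) {U : Finset V} (hU : ∀ i ∈ U, ∃ u ∈ M, u i ≠ 0)
    (hk : 2 * r * k ≤ U.card) :
    ∃ K : Finset (V → ZMod 2), ↑K ⊆ M ∧ IsSumFreeIn K M ∧ k ≤ K.card := by
  classical
  obtain ⟨J, hJM, hUJ⟩ := exists_subset_card_le_two_mul_hammingNorm (M := M.toFinset)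
    (by simpa using hU)
  obtain ⟨K, hKM, hKJ, hK⟩ := exists_isSumFreeIn (M := M) (J := J)
    (by simpa [← Finset.coe_subset] using hJM)
  refine ⟨K, hKM, hK, Nat.le_of_mul_le_mul_left ?_ (by positivity : 0 < 2 * r)⟩
  calc 2 * r * k ≤ 2 * hammingNorm (∑ u ∈ J, u) := hk.trans hUJ
    _ ≤ 2 * ∑ u ∈ K, hammingNorm u := by rw [← hKJ]; gcongr; exact hammingNorm_sum_le K id
    _ ≤ 2 * (K.card * r) := by
      gcongr
      exact Finset.sum_le_card_nsmul K _ r fun u hu => hM u (hKM hu)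
    _ = 2 * r * K.card := by ring

theorem exists_le_walshSum_of_cover [DecidableEq V] {c : (V → ZMod 2) → ℤ} (hc : c 0 = 0)
    (hr : 0 < r) (hcr : ∀ u, c u ≠ 0 → hammingNorm u ≤ r) {U : Finset V}
    (hU : ∀ i ∈ U, ∃ u, c u ≠ 0 ∧ u i ≠ 0) (hk : 2 * r * k ≤ U.card) :
    ∃ x, (k : ℤ) ≤ walshSum c x := by
  obtain ⟨K, hKc, hK, hkK⟩ := exists_isSumFreeIn_card_ge (M := c.support) hr hcr hU hk
  obtain ⟨x, hx⟩ := hK.exists_sum_abs_le hc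
  refine ⟨x, le_trans ?_ hx⟩
  calc (k : ℤ) ≤ ∑ _ ∈ K, (1 : ℤ) := by simpa using hkK
    _ ≤ ∑ u ∈ K, |c u| := Finset.sum_le_sum fun u hu => Int.one_le_abs (hKc hu)

end Cover

/-! ### Systems of equations as lists of numbers -/

/-- A weighted equation over `𝔽₂` as the random access machine reads it: the list of its variables,
its right-hand side and its weight. -/
structure FlatEq where
  vars : List ℕ
  b : ℕ
  w : ℕ

namespace FlatEq

/-- The encoding of an equation in the input. -/
def enc (e : FlatEq) : List ℕ := e.vars.length :: e.vars ++ [e.b, e.w]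

/-- The weight with the sign `(-1) ^ b`. -/
def signedWeight (e : FlatEq) : ℤ := if e.b = 0 then e.w else -e.w

/-- The variables as a set. Equations with the same set can be merged. -/
def varSet (e : FlatEq) : Finset ℕ := e.vars.toFinset

theorem mem_varSet {e : FlatEq} {v : ℕ} : v ∈ e.varSet ↔ v ∈ e.vars := List.mem_toFinset

/-- The equation encodes a `WeightedEq r n`. -/
structure Valid (r n : ℕ) (e : FlatEq) : Prop where
  sorted : e.vars.Pairwise (· < ·)
  lt : ∀ v ∈ e.vars, v < n
  ne_nil : e.vars ≠ []
  length_le : e.vars.length ≤ r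
  b_lt : e.b < 2
  w_pos : 0 < e.w

theorem Valid.nodup {r n : ℕ} {e : FlatEq} (h : e.Valid r n) : e.vars.Nodup :=
  h.sorted.imp fun h => h.ne

/-- The indicator vector of the variables of an equation. -/
def ind (n : ℕ) (e : FlatEq) : Fin n → ZMod 2 := fun i => if (i : ℕ) ∈ e.vars then 1 else 0

theorem ind_ne_zero_iff {n : ℕ} {e : FlatEq} {i : Fin n} : e.ind n i ≠ 0 ↔ (i : ℕ) ∈ e.vars := by
  simp [ind]

theorem Valid.ind_inj {r n : ℕ} {e e' : FlatEq} (h : e.Valid r n) (h' : e'.Valid r n) :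
    e.ind n = e'.ind n ↔ e.varSet = e'.varSet := by
  constructor
  · intro heq
    ext v
    rw [mem_varSet, mem_varSet]
    by_cases hv : v < n
    · rw [← ind_ne_zero_iff (i := ⟨v, hv⟩), heq, ind_ne_zero_iff]
    · exact iff_of_false (fun hm => hv (h.lt v hm)) fun hm => hv (h'.lt v hm)
  · intro heq
    ext i
    simp only [ind, ← mem_varSet, heq]

theorem Valid.ind_ne_zero {r n : ℕ} {e : FlatEq} (h : e.Valid r n) : e.ind n ≠ 0 := by
  obtain ⟨v, hv⟩ := List.exists_mem_of_ne_nil _ h.ne_nil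
  exact Function.ne_iff.2 ⟨⟨v, h.lt v hv⟩, ind_ne_zero_iff.2 hv⟩

theorem Valid.hammingNorm_ind_le {r n : ℕ} {e : FlatEq} (h : e.Valid r n) :
    hammingNorm (e.ind n) ≤ r := by
  rw [hammingNorm, ← Finset.card_map Fin.valEmbedding]
  refine (Finset.card_le_card (t := e.varSet) fun v hv => ?_).trans
    ((List.toFinset_card_le _).trans h.length_le)
  obtain ⟨i, hi, rfl⟩ := Finset.mem_map.1 hv
  exact mem_varSet.2 (ind_ne_zero_iff.1 (Finset.mem_filter.1 hi).2)

theorem Valid.prod_eq_walsh {r n : ℕ} {e : FlatEq} (h : e.Valid r n) (x : ℕ → ℤˣ) :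
    (e.vars.map x).prod = walsh (e.ind n) fun i => x i := by
  have hterm (i : Fin n) : x i ^ e.ind n i = if (i : ℕ) ∈ e.varSet then x i else 1 := by
    by_cases hi : (i : ℕ) ∈ e.vars <;> simp [ind, mem_varSet, hi]
  rw [← List.prod_toFinset _ h.nodup, walsh, Finset.prod_congr rfl fun i _ => hterm i,
    ← Finset.prod_range fun v => if v ∈ e.varSet then x v else 1, Finset.prod_ite_mem,
    Finset.inter_eq_right.2 fun v hv => Finset.mem_range.2 (h.lt v (mem_varSet.1 hv)), varSet]

end FlatEq

/-- The excess of the assignment that is given by the signs `x v = (-1) ^ z v`. -/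
def signExcess (l : List FlatEq) (x : ℕ → ℤˣ) : ℤ :=
  (l.map fun e => e.signedWeight * ((e.vars.map x).prod : ℤˣ).val).sum

/-- Some assignment has an excess of at least `k`. -/
def AttainsExcess (l : List FlatEq) (k : ℕ) : Prop := ∃ x, (k : ℤ) ≤ signExcess l x

section FiberWeight

variable {α : Type*} [DecidableEq α] {φ : FlatEq → α} {l : List FlatEq}

/-- The total signed weight of the equations on which `φ` takes the value `a`. -/
def fiberWeight (φ : FlatEq → α) (l : List FlatEq) (a : α) : ℤ :=
  ((l.filter (φ · = a)).map FlatEq.signedWeight).sum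

theorem fiberWeight_cons (e : FlatEq) (l : List FlatEq) (a : α) :
    fiberWeight φ (e :: l) a = (if φ e = a then e.signedWeight else 0) + fiberWeight φ l a := by
  by_cases h : φ e = a <;> simp [fiberWeight, h]

theorem exists_of_fiberWeight_ne_zero {a : α} (h : fiberWeight φ l a ≠ 0) : ∃ e ∈ l, φ e = a := by
  contrapose! h
  rw [fiberWeight, List.filter_eq_nil_iff.2 (by simpa using h), List.map_nil, List.sum_nil]

theorem fiberWeight_congr {β : Type*} [DecidableEq β] {ψ : FlatEq → β} {a : α} {b : β}
    (h : ∀ e ∈ l, φ e = a ↔ ψ e = b) : fiberWeight φ l a = fiberWeight ψ l b := by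
  rw [fiberWeight, fiberWeight, List.filter_congr fun e he => decide_eq_decide.2 (h e he)]

theorem sum_signedWeight_mul {U : Finset α} (hU : ∀ e ∈ l, φ e ∈ U) (g : α → ℤ) :
    (l.map fun e => e.signedWeight * g (φ e)).sum = ∑ a ∈ U, fiberWeight φ l a * g a := by
  induction l with
  | nil => simp [fiberWeight]
  | cons e l ih =>
    simp only [List.forall_mem_cons] at hU
    simp only [List.map_cons, List.sum_cons, fiberWeight_cons, add_mul, ite_mul, zero_mul,
      Finset.sum_add_distrib, Finset.sum_ite_eq, hU.1, if_true, ih hU.2]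

end FiberWeight

/-- The total signed weight of the equations in `l` with the same variables as `e`. -/
def netWeight (l : List FlatEq) (e : FlatEq) : ℤ := fiberWeight FlatEq.varSet l e.varSet

section SignExcess

variable {r n k : ℕ} {l : List FlatEq}

theorem signExcess_eq_sum (hl : ∀ e ∈ l, e.vars.Nodup) (x : ℕ → ℤˣ) :
    signExcess l x = ∑ T ∈ (l.map FlatEq.varSet).toFinset,
      fiberWeight FlatEq.varSet l T * (∏ v ∈ T, x v : ℤˣ) := by
  rw [← sum_signedWeight_mul (fun e he => List.mem_toFinset.2 (List.mem_map_of_mem he))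
    fun T => ((∏ v ∈ T, x v : ℤˣ) : ℤ), signExcess]
  congr 1
  refine List.map_congr_left fun e he => ?_
  rw [FlatEq.varSet, List.prod_toFinset _ (hl e he)]

theorem signExcess_congr (hl : ∀ e ∈ l, e.vars.Nodup) {x y : ℕ → ℤˣ}
    (h : ∀ e ∈ l, netWeight l e ≠ 0 → ∀ v ∈ e.vars, x v = y v) :
    signExcess l x = signExcess l y := by
  rw [signExcess_eq_sum hl, signExcess_eq_sum hl]
  refine Finset.sum_congr rfl fun T _ => ?_
  by_cases hT : fiberWeight FlatEq.varSet l T = 0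
  · rw [hT, zero_mul, zero_mul]
  · obtain ⟨e, he, rfl⟩ := exists_of_fiberWeight_ne_zero hT
    rw [Finset.prod_congr rfl fun v hv => h e he hT v (FlatEq.mem_varSet.1 hv)]

theorem signExcess_eq_walshSum (hl : ∀ e ∈ l, e.Valid r n) (x : ℕ → ℤˣ) :
    signExcess l x = walshSum (fiberWeight (FlatEq.ind n) l) fun i => x i := by
  rw [walshSum, ← sum_signedWeight_mul (fun _ _ => Finset.mem_univ _)
    fun u => (walsh u fun i : Fin n => x i : ℤ), signExcess]
  congr 1
  exact List.map_congr_left fun e he => by rw [(hl e he).prod_eq_walsh]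

theorem attainsExcess_of_le_walshSum (hl : ∀ e ∈ l, e.Valid r n)
    (h : ∃ x, (k : ℤ) ≤ walshSum (fiberWeight (FlatEq.ind n) l) x) : AttainsExcess l k := by
  obtain ⟨x, hx⟩ := h
  obtain ⟨y, rfl⟩ := Fin.val_injective.surjective_comp_right x
  exact ⟨y, by rwa [signExcess_eq_walshSum hl]⟩

theorem fiberWeight_ind_zero (hl : ∀ e ∈ l, e.Valid r n) : fiberWeight (FlatEq.ind n) l 0 = 0 := by
  by_contra h
  obtain ⟨e, he, h0⟩ := exists_of_fiberWeight_ne_zero h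
  exact (hl e he).ind_ne_zero h0

theorem fiberWeight_ind (hl : ∀ e ∈ l, e.Valid r n) {e : FlatEq} (he : e ∈ l) :
    fiberWeight (FlatEq.ind n) l (e.ind n) = netWeight l e :=
  fiberWeight_congr fun e' he' => (hl e' he').ind_inj (hl e he)

theorem attainsExcess_of_le_abs_netWeight (hl : ∀ e ∈ l, e.Valid r n) {e : FlatEq} (he : e ∈ l)
    (hk : k ≤ |netWeight l e|) : AttainsExcess l k := by
  obtain ⟨x, hx⟩ := exists_abs_coeff_le_walshSum (fiberWeight_ind_zero hl) (e.ind n)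
  rw [fiberWeight_ind hl he] at hx
  exact attainsExcess_of_le_walshSum hl ⟨x, hk.trans hx⟩

theorem attainsExcess_of_cover (hl : ∀ e ∈ l, e.Valid r n) (hr : 0 < r) {D : List ℕ}
    (hD : D.Nodup) (hmem : ∀ v ∈ D, ∃ e ∈ l, netWeight l e ≠ 0 ∧ v ∈ e.vars)
    (hk : 2 * r * k ≤ D.length) : AttainsExcess l k := by
  have hDn : ∀ v ∈ D.toFinset, v < n := fun v hv => by
    obtain ⟨e, he, -, hve⟩ := hmem v (List.mem_toFinset.1 hv)
    exact (hl e he).lt v hve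
  refine attainsExcess_of_le_walshSum hl (exists_le_walshSum_of_cover (fiberWeight_ind_zero hl) hr
    (fun u hu => ?_) (U := D.toFinset.attachFin hDn) (fun i hi => ?_) ?_)
  · obtain ⟨e, he, rfl⟩ := exists_of_fiberWeight_ne_zero hu
    exact (hl e he).hammingNorm_ind_le
  · obtain ⟨e, he, h0, hv⟩ := hmem i (by simpa [Finset.mem_attachFin] using hi)
    exact ⟨e.ind n, by rwa [fiberWeight_ind hl he], FlatEq.ind_ne_zero_iff.2 hv⟩
  · rwa [Finset.card_attachFin, List.toFinset_card_of_nodup hD]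

end SignExcess

/-! ### First occurrences and labels -/

section FirstOccs

variable {α β : Type*} [DecidableEq β] {f : α → β} {L : List α} {a : α}

/-- The elements of a list at which a value of `f` occurs for the first time. -/
def firstOccs (f : α → β) (L : List α) : List α := (L.reverse.pwFilter (f · ≠ f ·)).reverse

theorem firstOccs_nil : firstOccs f [] = [] := rfl

theorem map_firstOccs (f : α → β) (L : List α) :
    (firstOccs f L).map f = (L.map f).reverse.dedup.reverse := by
  have := List.pwFilter_map (R := (· ≠ ·)) f L.reverse
  rw [List.map_reverse] at this
  rw [firstOccs, List.map_reverse, ← this, List.dedup]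

theorem mem_map_firstOccs {b : β} : b ∈ (firstOccs f L).map f ↔ b ∈ L.map f := by
  rw [map_firstOccs, List.mem_reverse, List.mem_dedup, List.mem_reverse]

theorem nodup_map_firstOccs (f : α → β) (L : List α) : ((firstOccs f L).map f).Nodup := by
  rw [map_firstOccs]
  exact List.nodup_reverse.2 (List.nodup_dedup _)

theorem firstOccs_sublist (f : α → β) (L : List α) : (firstOccs f L).Sublist L :=
  List.reverse_sublist.1 (by rw [firstOccs, List.reverse_reverse]; exact List.pwFilter_sublist _)

theorem forall_mem_firstOccs_ne_iff :
    (∀ b ∈ L.reverse.pwFilter (f · ≠ f ·), f a ≠ f b) ↔ f a ∉ L.map f := by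
  rw [← mem_map_firstOccs]
  simp only [firstOccs, List.map_reverse, List.mem_reverse, List.mem_map, not_exists, not_and,
    ne_eq, eq_comm]

theorem firstOccs_concat_of_mem (h : f a ∈ L.map f) :
    firstOccs f (L ++ [a]) = firstOccs f L := by
  rw [firstOccs, List.reverse_concat, firstOccs,
    List.pwFilter_cons_of_neg (mt forall_mem_firstOccs_ne_iff.1 (not_not.2 h))]

theorem firstOccs_concat_of_notMem (h : f a ∉ L.map f) :
    firstOccs f (L ++ [a]) = firstOccs f L ++ [a] := by
  rw [firstOccs, List.reverse_concat,
    List.pwFilter_cons_of_pos (forall_mem_firstOccs_ne_iff.2 h), List.reverse_cons, firstOccs]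

end FirstOccs

theorem mem_firstOccs_id {L : List ℕ} {v : ℕ} : v ∈ firstOccs id L ↔ v ∈ L := by
  simpa only [List.map_id] using mem_map_firstOccs (f := id)

theorem nodup_firstOccs_id (L : List ℕ) : (firstOccs id L).Nodup := by
  simpa only [List.map_id] using nodup_map_firstOccs id L

/-- The position of a variable in the list `D`, counted from `1`, and `0` if it is not there. This
is what a bank of the memory holds that is filled while `D` grows. -/
def label (D : List ℕ) (v : ℕ) : ℕ := if v ∈ D then D.idxOf v + 1 else 0

theorem label_ne_zero_iff {D : List ℕ} {v : ℕ} : label D v ≠ 0 ↔ v ∈ D := by simp [label]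

theorem label_le (D : List ℕ) (v : ℕ) : label D v ≤ D.length := by
  unfold label
  split_ifs with h
  · exact List.idxOf_lt_length_of_mem h
  · exact Nat.zero_le _

theorem label_injOn (D : List ℕ) : Set.InjOn (label D) {v | v ∈ D} := by
  intro v (hv : v ∈ D) v' (hv' : v' ∈ D) h
  simp only [label, hv, hv', if_true, add_left_inj] at h
  exact (List.idxOf_inj hv).1 h

theorem label_concat {D : List ℕ} {v : ℕ} (h : v ∉ D) :
    label (D ++ [v]) = Function.update (label D) v (D.length + 1) := by
  ext a
  by_cases ha : a = v
  · subst ha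
    simp [label, List.idxOf_append, h]
  · by_cases haD : a ∈ D <;> simp [label, List.idxOf_append, ha, haD]

/-! ### Merging equations -/

/-- The equations in `l` that do not cancel: those whose net weight in `eqs` is nonzero. -/
def essentialEqs (eqs l : List FlatEq) : List FlatEq := l.filter (netWeight eqs · ≠ 0)

/-- The variables of the equations in `l` that do not cancel, in the order of their first
occurrences. -/
def essentialVars (eqs l : List FlatEq) : List ℕ :=
  firstOccs id ((essentialEqs eqs l).flatMap FlatEq.vars)

/-- One equation from `l` for every set of variables of nonzero net weight in `eqs`. -/
def representatives (eqs l : List FlatEq) : List FlatEq :=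
  firstOccs FlatEq.varSet (essentialEqs eqs l)

/-- The merger of the equations in `eqs` that have the same variables as `e`, where a variable is
renamed to its position in the list `D`. -/
def FlatEq.reduce (eqs : List FlatEq) (D : List ℕ) (e : FlatEq) : FlatEq where
  vars := (List.range D.length).filter (· ∈ e.vars.map D.idxOf)
  b := if netWeight eqs e < 0 then 1 else 0
  w := (netWeight eqs e).natAbs

/-- The system that the kernelization produces. -/
def reducedSystem (eqs : List FlatEq) : List FlatEq :=
  (representatives eqs eqs).map (FlatEq.reduce eqs (essentialVars eqs eqs))

section Reduction

variable {eqs l : List FlatEq} {D : List ℕ} {e : FlatEq} {r n k v : ℕ}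

theorem mem_essentialEqs : e ∈ essentialEqs eqs l ↔ e ∈ l ∧ netWeight eqs e ≠ 0 := by
  simp [essentialEqs]

theorem mem_essentialVars :
    v ∈ essentialVars eqs l ↔ ∃ e ∈ l, netWeight eqs e ≠ 0 ∧ v ∈ e.vars := by
  simp only [essentialVars, mem_firstOccs_id, List.mem_flatMap, mem_essentialEqs, and_assoc]

theorem mem_essentialVars_of_mem (he : e ∈ essentialEqs eqs l) (hv : v ∈ e.vars) :
    v ∈ essentialVars eqs l :=
  mem_firstOccs_id.2 (List.mem_flatMap.2 ⟨e, he, hv⟩)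

theorem nodup_essentialVars (eqs l : List FlatEq) : (essentialVars eqs l).Nodup :=
  nodup_firstOccs_id _

theorem mem_map_varSet_representatives {T : Finset ℕ} :
    T ∈ (representatives eqs l).map FlatEq.varSet ↔ T ∈ (essentialEqs eqs l).map FlatEq.varSet :=
  mem_map_firstOccs

theorem nodup_map_varSet_representatives (eqs l : List FlatEq) :
    ((representatives eqs l).map FlatEq.varSet).Nodup :=
  nodup_map_firstOccs _ _

theorem mem_essentialEqs_of_mem_representatives (he : e ∈ representatives eqs l) :
    e ∈ essentialEqs eqs l :=
  (firstOccs_sublist _ _).subset he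

namespace FlatEq

theorem signedWeight_reduce (eqs : List FlatEq) (D : List ℕ) (e : FlatEq) :
    (e.reduce eqs D).signedWeight = netWeight eqs e := by
  simp only [signedWeight, reduce, ite_eq_right_iff, one_ne_zero, imp_false, not_lt]
  split_ifs <;> omega

theorem nodup_vars_reduce (eqs : List FlatEq) (D : List ℕ) (e : FlatEq) :
    (e.reduce eqs D).vars.Nodup :=
  List.nodup_range.filter _

theorem varSet_reduce (hD : ∀ v ∈ e.vars, v ∈ D) :
    (e.reduce eqs D).varSet = e.varSet.image D.idxOf := by
  ext i
  simp only [reduce, varSet, List.mem_toFinset, List.mem_filter, List.mem_range, Finset.mem_image,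
    List.mem_map, decide_eq_true_eq, and_iff_right_iff_imp, forall_exists_index, and_imp]
  rintro v hv rfl
  exact List.idxOf_lt_length_of_mem (hD v hv)

theorem prod_vars_reduce (he : e.vars.Nodup) (hD : ∀ v ∈ e.vars, v ∈ D) (y : ℕ → ℤˣ) :
    ((e.reduce eqs D).vars.map y).prod = (e.vars.map fun v => y (D.idxOf v)).prod := by
  rw [← List.prod_toFinset _ (nodup_vars_reduce eqs D e), ← List.prod_toFinset _ he, ← varSet,
    varSet_reduce hD, Finset.prod_image, varSet]
  exact fun v hv _ _ h => (List.idxOf_inj (hD v (mem_varSet.1 hv))).1 h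

theorem Valid.reduce (he : e.Valid r n) (hD : ∀ v ∈ e.vars, v ∈ D) (h0 : netWeight eqs e ≠ 0) :
    (e.reduce eqs D).Valid r D.length where
  sorted := List.pairwise_lt_range.filter _
  lt v hv := List.mem_range.1 (List.mem_filter.1 hv).1
  ne_nil h := by
    have := varSet_reduce (eqs := eqs) hD
    rw [varSet, h, List.toFinset_nil, eq_comm, Finset.image_eq_empty, varSet,
      List.toFinset_eq_empty_iff] at this
    exact he.ne_nil this
  length_le := by
    rw [← List.toFinset_card_of_nodup (nodup_vars_reduce eqs D e), ← varSet, varSet_reduce hD]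
    exact Finset.card_image_le.trans ((List.toFinset_card_le _).trans he.length_le)
  b_lt := by
    simp only [FlatEq.reduce]
    split_ifs <;> omega
  w_pos := Int.natAbs_pos.2 h0

end FlatEq

theorem signExcess_reducedSystem (hl : ∀ e ∈ eqs, e.vars.Nodup) (y : ℕ → ℤˣ) :
    signExcess (reducedSystem eqs) y =
      signExcess eqs fun v => y ((essentialVars eqs eqs).idxOf v) := by
  let x (v : ℕ) := y ((essentialVars eqs eqs).idxOf v)
  let g (T : Finset ℕ) : ℤ := fiberWeight FlatEq.varSet eqs T * (∏ v ∈ T, x v : ℤˣ)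
  have hsum : signExcess (reducedSystem eqs) y =
      (((representatives eqs eqs).map FlatEq.varSet).map g).sum := by
    rw [signExcess, reducedSystem, List.map_map, List.map_map]
    congr 1
    refine List.map_congr_left fun e he => ?_
    have hmem := mem_essentialEqs_of_mem_representatives he
    have hnodup := hl e (mem_essentialEqs.1 hmem).1
    simp only [Function.comp_apply, FlatEq.signedWeight_reduce, g, netWeight, FlatEq.varSet,
      FlatEq.prod_vars_reduce hnodup fun _ hv => mem_essentialVars_of_mem hmem hv,
      List.prod_toFinset _ hnodup, x]
  rw [hsum, ← List.sum_toFinset _ (nodup_map_varSet_representatives _ _),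
    signExcess_eq_sum hl]
  refine Finset.sum_subset (fun T hT => ?_) fun T _ hT => ?_
  · obtain ⟨e, he, rfl⟩ := List.mem_map.1 (mem_map_varSet_representatives.1
      (List.mem_toFinset.1 hT))
    exact List.mem_toFinset.2 (List.mem_map_of_mem (mem_essentialEqs.1 he).1)
  · have h0 : fiberWeight FlatEq.varSet eqs T = 0 := by
      by_contra hne
      obtain ⟨e, he, rfl⟩ := exists_of_fiberWeight_ne_zero hne
      exact hT (List.mem_toFinset.2 (mem_map_varSet_representatives.2
        (List.mem_map_of_mem (mem_essentialEqs.2 ⟨he, hne⟩))))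
    rw [h0, zero_mul]

theorem attainsExcess_reducedSystem_iff (hl : ∀ e ∈ eqs, e.vars.Nodup) :
    AttainsExcess (reducedSystem eqs) k ↔ AttainsExcess eqs k := by
  constructor
  · rintro ⟨y, hk⟩
    exact ⟨_, hk.trans_eq (signExcess_reducedSystem hl y)⟩
  · rintro ⟨x, hk⟩
    refine ⟨fun i => x ((essentialVars eqs eqs).getD i 0), hk.trans_eq ?_⟩
    rw [signExcess_reducedSystem hl]
    refine signExcess_congr hl fun e he h0 v hv => ?_
    have := List.idxOf_lt_length_of_mem (mem_essentialVars.2 ⟨e, he, h0, hv⟩)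
    simp [this]

theorem valid_reducedSystem (hl : ∀ e ∈ eqs, e.Valid r n) :
    ∀ e ∈ reducedSystem eqs, e.Valid r (essentialVars eqs eqs).length := by
  intro _ he'
  obtain ⟨e, he, rfl⟩ := List.mem_map.1 he'
  have hmem := mem_essentialEqs_of_mem_representatives he
  exact (hl e (mem_essentialEqs.1 hmem).1).reduce (fun v hv => mem_essentialVars_of_mem hmem hv)
    (mem_essentialEqs.1 hmem).2

theorem length_reducedSystem_le (eqs : List FlatEq) :
    (reducedSystem eqs).length ≤ 2 ^ (essentialVars eqs eqs).length := by
  have hsub : ((representatives eqs eqs).map FlatEq.varSet).toFinset ⊆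
      (essentialVars eqs eqs).toFinset.powerset := by
    intro T hT
    obtain ⟨e, he, rfl⟩ := List.mem_map.1 (List.mem_toFinset.1 hT)
    exact Finset.mem_powerset.2 fun v hv => List.mem_toFinset.2 (mem_essentialVars_of_mem
      (mem_essentialEqs_of_mem_representatives he) (FlatEq.mem_varSet.1 hv))
  have := Finset.card_le_card hsub
  rwa [List.toFinset_card_of_nodup (nodup_map_varSet_representatives _ _), Finset.card_powerset,
    List.toFinset_card_of_nodup (nodup_essentialVars _ _), List.length_map,
    ← List.length_map (f := FlatEq.reduce eqs _)] at this

end Reduction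

/-! ### The list form of a system -/

namespace WeightedEq

variable {r n : ℕ}

/-- The equation as the random access machine reads it. -/
def flat (e : WeightedEq r n) : FlatEq where
  vars := (e.S.sort (· ≤ ·)).map fun i : Fin n => (i : ℕ)
  b := e.b.val
  w := e.w

theorem valid_flat (e : WeightedEq r n) : e.flat.Valid r n where
  sorted := List.pairwise_map.2 ((Finset.sortedLT_sort e.S).pairwise.imp fun h => h)
  lt v hv := by
    obtain ⟨i, -, rfl⟩ := List.mem_map.1 hv
    exact i.2
  ne_nil h := e.nonempty.ne_empty (by simpa [flat] using congrArg List.length h)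
  length_le := by simpa [flat] using e.card_le
  b_lt := ZMod.val_lt e.b
  w_pos := e.w_pos

theorem signedWeight_mul_prod (e : WeightedEq r n) {z : Fin n → ZMod 2} {x : ℕ → ℤˣ}
    (hx : ∀ i : Fin n, x i = (-1) ^ z i) :
    e.flat.signedWeight * ((e.flat.vars.map x).prod : ℤˣ).val =
      if e.Sat z then (e.w : ℤ) else -e.w := by
  have hprod : (e.flat.vars.map x).prod = (-1) ^ ∑ i ∈ e.S, z i := by
    rw [flat, List.map_map, ← List.prod_toFinset _ (Finset.sort_nodup _ _), Finset.sort_toFinset,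
      uzpow_sum]
    exact Finset.prod_congr rfl fun i _ => hx i
  have hsign : ∀ a b : ZMod 2, (if b.val = 0 then 1 else -1) * (((-1) ^ a : ℤˣ) : ℤ) =
      if a = b then 1 else -1 := by decide
  have hsigned : e.flat.signedWeight = e.w * if e.b.val = 0 then 1 else -1 := by
    rw [mul_ite, mul_one, mul_neg_one]
    rfl
  rw [hprod, hsigned, mul_assoc, hsign, mul_ite, mul_one, mul_neg_one]
  rfl

end WeightedEq

theorem FlatEq.Valid.exists_flat {r n : ℕ} {e : FlatEq} (h : e.Valid r n) :
    ∃ e' : WeightedEq r n, e'.flat = e := by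
  let S : Finset (Fin n) := Finset.univ.filter fun i => (i : ℕ) ∈ e.vars
  have hS : ((S.sort (· ≤ ·)).map fun i : Fin n => (i : ℕ)) = e.vars := by
    refine List.Perm.eq_of_pairwise (le := (· < ·)) (fun a b _ _ h h' => absurd h' h.asymm)
      (List.pairwise_map.2 ((Finset.sortedLT_sort _).pairwise.imp fun h => h)) h.sorted
      ((List.perm_ext_iff_of_nodup ((Finset.sort_nodup _ _).map Fin.val_injective) h.nodup).2
        fun v => ?_)
    simp only [S, List.mem_map, Finset.mem_sort, Finset.mem_filter, Finset.mem_univ, true_and]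
    exact ⟨by rintro ⟨i, hi, rfl⟩; exact hi, fun hv => ⟨⟨v, h.lt v hv⟩, hv, rfl⟩⟩
  have hcard : S.card = e.vars.length := by
    rw [← Finset.length_sort (· ≤ ·), ← hS, List.length_map]
  refine ⟨⟨S, e.b, e.w, Finset.card_pos.1 (hcard ▸ List.length_pos_iff.2 h.ne_nil),
    hcard ▸ h.length_le, h.w_pos⟩, ?_⟩
  simp only [WeightedEq.flat, hS, ZMod.val_cast_of_lt h.b_lt]

namespace RLinSystem

variable {r : ℕ} (I : RLinSystem r)

/-- The equations of a system as the random access machine reads them. -/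
def flat : List FlatEq := I.eqs.map WeightedEq.flat

theorem length_flat : I.flat.length = I.m := List.length_map _

theorem valid_flat : ∀ e ∈ I.flat, e.Valid r I.n := by
  intro e he
  obtain ⟨e, -, rfl⟩ := List.mem_map.1 he
  exact e.valid_flat

theorem exists_flat_eq {n : ℕ} {es : List FlatEq} (h : ∀ e ∈ es, e.Valid r n) :
    ∃ I : RLinSystem r, I.n = n ∧ I.flat = es := by
  have hes : es ∈ Set.range (List.map (WeightedEq.flat (r := r) (n := n))) := by
    rw [Set.range_list_map]
    exact fun e he => (h e he).exists_flat
  obtain ⟨eqs, rfl⟩ := hes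
  exact ⟨⟨n, eqs⟩, rfl, rfl⟩

theorem encode_eq : I.encode = I.n :: I.flat.length :: I.flat.flatMap FlatEq.enc := by
  simp only [encode, m, flat, List.flatMap_map, FlatEq.enc, WeightedEq.flat, List.length_map,
    Finset.length_sort, List.pure_def, List.bind_eq_flatMap, ← List.map_eq_flatMap, List.map_id']

theorem excess_eq_signExcess {z : Fin I.n → ZMod 2} {x : ℕ → ℤˣ}
    (hx : ∀ i : Fin I.n, x i = (-1) ^ z i) : I.excess z = signExcess I.flat x := by
  obtain ⟨n, eqs⟩ := I
  change Fin n → ZMod 2 at z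
  have hterm (e : WeightedEq r n) := e.signedWeight_mul_prod (z := z) hx
  simp only [excess, flat, signExcess, List.map_map, Function.comp_def, hterm]
  clear hterm hx
  induction eqs with
  | nil => rfl
  | cons e eqs ih =>
    simp only [List.map_cons, List.sum_cons, ← ih]
    by_cases h : e.Sat z <;> simp [h] <;> ring

end RLinSystem

theorem maxRLinAA_yes_iff {r : ℕ} (I : RLinSystem r) (k : ℕ) :
    (maxRLinAA r).Yes I k ↔ AttainsExcess I.flat k := by
  have hyes : (maxRLinAA r).Yes I k ↔ ∃ z, (k : ℤ) ≤ I.excess z := by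
    change (k : ℤ) ≤ I.maxExcess ↔ _
    exact (Finset.le_sup'_iff _).trans (by simp only [Finset.mem_univ, true_and])
  have hsurj : Function.Surjective fun a : ZMod 2 => ((-1) ^ a : ℤˣ) := by decide
  rw [hyes]
  constructor
  · rintro ⟨z, hz⟩
    obtain ⟨x, hx⟩ := Fin.val_injective.surjective_comp_right fun i => ((-1) ^ z i : ℤˣ)
    exact ⟨x, by rwa [← I.excess_eq_signExcess (congrFun hx)]⟩
  · rintro ⟨x, hx⟩
    choose z hz using fun i : Fin I.n => hsurj (x i)
    exact ⟨z, by rwa [I.excess_eq_signExcess fun i => (hz i).symm]⟩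

/-! ### Reasoning about RAM programs -/

namespace RAMState

@[simp] theorem write_of_ne (s : RAMState) {b b' : ℕ} (a v : ℕ) (h : b' ≠ b) :
    s.write b a v b' = s b' :=
  Function.update_of_ne h _ _

@[simp] theorem write_self (s : RAMState) (b a v : ℕ) :
    s.write b a v b = Function.update (s b) a v :=
  Function.update_self _ _ _

end RAMState

/-- The register stored at address `0` of a bank. -/
abbrev RAMExpr.reg (b : ℕ) : RAMExpr := .get b (.const 0)

namespace RAMProg

/-- Whether the program contains an assignment to a cell of the given bank. -/
def writes : RAMProg → ℕ → Bool
  | skip, _ => false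
  | assign b _ _, c => b == c
  | seq P Q, c => P.writes c || Q.writes c
  | cond _ P Q, c => P.writes c || Q.writes c
  | loop _ P, c => P.writes c

/-- A bound for the running time, as a polynomial in a bound for the number of iterations of each
loop whenever it is run. -/
noncomputable def timeBound : RAMProg → Polynomial ℕ
  | skip => 1
  | assign _ a e => .C (a.cost + e.cost + 1)
  | seq P Q => P.timeBound + Q.timeBound
  | cond e P Q => .C (e.cost + 1) + (P.timeBound + Q.timeBound)
  | loop e P => .X * (.C (e.cost + 1) + P.timeBound) + .C (e.cost + 1)

end RAMProg

theorem RAMExec.eq_of_writes_eq_false {P : RAMProg} {s s' : RAMState} {t : ℕ}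
    (h : RAMExec P s t s') {b : ℕ} (hb : P.writes b = false) : s' b = s b := by
  induction h with
  | skip => rfl
  | assign c a e s =>
    refine RAMState.write_of_ne _ _ _ ?_
    rintro rfl
    simp [RAMProg.writes] at hb
  | seq _ _ ih ih' =>
    simp only [RAMProg.writes, Bool.or_eq_false_iff] at hb
    rw [ih' hb.2, ih hb.1]
  | cond_true _ _ ih =>
    simp only [RAMProg.writes, Bool.or_eq_false_iff] at hb
    exact ih hb.1
  | cond_false _ _ ih =>
    simp only [RAMProg.writes, Bool.or_eq_false_iff] at hb
    exact ih hb.2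
  | loop_done _ => rfl
  | loop_step _ _ _ ih ih' => rw [ih' hb, ih hb]

namespace RAMProg

/-- The states agree outside the banks to which the program writes. -/
def Frame (P : RAMProg) (s s' : RAMState) : Prop := ∀ b, P.writes b = false → s' b = s b

namespace Frame

variable {P Q : RAMProg} {s s' s'' : RAMState}

theorem refl (P : RAMProg) (s : RAMState) : Frame P s s := fun _ _ => rfl

theorem trans (h : Frame P s s') (h' : Frame P s' s'') : Frame P s s'' := fun b hb =>
  (h' b hb).trans (h b hb)

theorem mono (h : Frame P s s') (hPQ : ∀ b, Q.writes b = false → P.writes b = false) :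
    Frame Q s s' := fun b hb => h b (hPQ b hb)

theorem write (h : Frame P s s') {b : ℕ} (hb : P.writes b = true) (a v : ℕ) :
    Frame P s (s'.write b a v) := by
  intro c hc
  rw [RAMState.write_of_ne, h c hc]
  rintro rfl
  exact Bool.false_ne_true (hc.symm.trans hb)

end Frame

/-- A total-correctness triple: from `s`, the program halts within its time bound for `B` loop
iterations in a state that satisfies `Q`. -/
def Runs (B : ℕ) (P : RAMProg) (s : RAMState) (Q : RAMState → Prop) : Prop :=
  ∃ (t : ℕ) (s' : RAMState), t ≤ P.timeBound.eval B ∧ RAMExec P s t s' ∧ Q s'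

namespace Runs

variable {B : ℕ} {P P' : RAMProg} {s : RAMState} {Q R : RAMState → Prop}

theorem mono (h : Runs B P s Q) (hQR : ∀ s', Frame P s s' → Q s' → R s') : Runs B P s R := by
  obtain ⟨t, s', ht, he, hq⟩ := h
  exact ⟨t, s', ht, he, hQR s' (fun _ hb => he.eq_of_writes_eq_false hb) hq⟩

theorem skip (h : Q s) : Runs B .skip s Q := ⟨1, s, by simp [timeBound], .skip s, h⟩

theorem assign {b : ℕ} {a e : RAMExpr} (h : Q (s.write b (a.eval s) (e.eval s))) :
    Runs B (.assign b a e) s Q := ⟨_, _, by simp [timeBound], .assign b a e s, h⟩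

theorem seq (h : Runs B P s fun s' => Runs B P' s' Q) : Runs B (.seq P P') s Q := by
  obtain ⟨t, s', ht, he, t', s'', ht', he', hq⟩ := h
  refine ⟨t + t', s'', ?_, .seq he he', hq⟩
  simpa only [timeBound, Polynomial.eval_add] using add_le_add ht ht'

theorem cond {e : RAMExpr} (h₁ : e.eval s ≠ 0 → Runs B P s Q) (h₀ : e.eval s = 0 → Runs B P' s Q) :
    Runs B (.cond e P P') s Q := by
  by_cases h : e.eval s = 0
  · obtain ⟨t, s', ht, he, hq⟩ := h₀ h
    refine ⟨_, s', ?_, .cond_false h he, hq⟩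
    simp only [timeBound, Polynomial.eval_add, Polynomial.eval_C]
    omega
  · obtain ⟨t, s', ht, he, hq⟩ := h₁ h
    refine ⟨_, s', ?_, .cond_true h he, hq⟩
    simp only [timeBound, Polynomial.eval_add, Polynomial.eval_C]
    omega

theorem loop {e : RAMExpr} {n : ℕ} (hn : n ≤ B) (I : ℕ → RAMState → Prop) (h₀ : I 0 s)
    (hstep : ∀ j s, j < n → I j s → e.eval s ≠ 0 ∧ Runs B P s (I (j + 1)))
    (hend : ∀ s, I n s → e.eval s = 0 ∧ Q s) : Runs B (.loop e P) s Q := by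
  have run_from : ∀ d j s, j + d = n → I j s → ∃ (t : ℕ) (s' : RAMState),
      t ≤ d * (e.cost + 1 + P.timeBound.eval B) + (e.cost + 1) ∧
        RAMExec (.loop e P) s t s' ∧ Q s' := by
    intro d
    induction d with
    | zero =>
      rintro j s rfl hI
      obtain ⟨he, hq⟩ := hend s hI
      exact ⟨_, s, by simp, .loop_done he, hq⟩
    | succ d ih =>
      intro j s hj hI
      obtain ⟨he, t, s', ht, hex, hI'⟩ := hstep j s (by omega) hI
      obtain ⟨t', s'', ht', hex', hq⟩ := ih (j + 1) s' (by omega) hI'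
      refine ⟨_, s'', ?_, .loop_step he hex hex', hq⟩
      rw [Nat.succ_mul]
      omega
  obtain ⟨t, s', ht, he, hq⟩ := run_from n 0 s (by omega) h₀
  refine ⟨t, s', ht.trans ?_, he, hq⟩
  simp only [timeBound, Polynomial.eval_add, Polynomial.eval_mul, Polynomial.eval_X,
    Polynomial.eval_C]
  gcongr

end Runs

/-- Assignment to a register. -/
abbrev setReg (b : ℕ) (e : RAMExpr) : RAMProg := .assign b (.const 0) e

end RAMProg

infixr:50 ";;" => RAMProg.seq

namespace RAMProg

/-- Repeat `P` for the values `0, …, e - 1` of the register `i`. -/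
def forTo (i : ℕ) (e : RAMExpr) (P : RAMProg) : RAMProg :=
  setReg i (.const 0) ;; .loop (.sub e (.reg i)) (P ;; setReg i (.add (.reg i) (.const 1)))

theorem writes_forTo (i : ℕ) (e : RAMExpr) (P : RAMProg) (b : ℕ) :
    (forTo i e P).writes b = (i == b || P.writes b) := by
  simp only [forTo, writes, Bool.or_comm (P.writes b), ← Bool.or_assoc, Bool.or_self]

theorem Runs.forTo {B n i : ℕ} {e : RAMExpr} {P : RAMProg} {s₀ : RAMState}
    (I : ℕ → RAMState → Prop) (hn : n ≤ B) (hw : P.writes i = false)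
    (he : ∀ s, Frame (forTo i e P) s₀ s → e.eval s = n)
    (hst : ∀ j s v, I j s → I j (s.write i 0 v)) (h₀ : I 0 s₀)
    (hstep : ∀ j s, j < n → Frame (RAMProg.forTo i e P) s₀ s → s i 0 = j → I j s →
      Runs B P s (I (j + 1))) :
    Runs B (RAMProg.forTo i e P) s₀ (I n) := by
  have hwi : (RAMProg.forTo i e P).writes i = true := by simp [writes_forTo]
  have hwP (b : ℕ) (hb : (RAMProg.forTo i e P).writes b = false) : P.writes b = false := by
    rw [writes_forTo, Bool.or_eq_false_iff] at hb
    exact hb.2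
  refine .seq (.assign (.loop hn
    (fun j s => Frame (RAMProg.forTo i e P) s₀ s ∧ s i 0 = j ∧ I j s)
    ⟨(Frame.refl _ _).write hwi _ _, by simp [RAMExpr.eval], hst _ _ _ h₀⟩ ?_ ?_))
  · rintro j s hj ⟨hf, hi, hI⟩
    refine ⟨by simp only [RAMExpr.eval, he s hf, hi]; omega, .seq ((hstep j s hj hf hi hI).mono ?_)⟩
    intro s' hf' hI'
    exact .assign ⟨(hf.trans (hf'.mono hwP)).write hwi _ _, by simp [RAMExpr.eval, hf' i hw, hi],
      hst _ _ _ hI'⟩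
  · rintro s ⟨hf, hi, hI⟩
    exact ⟨by simp [RAMExpr.eval, he s hf, hi], hI⟩

end RAMProg

/-! ### Lists in memory -/

/-- The memory bank holds the list from the given address on. -/
def Holds (mem : ℕ → ℕ) (p : ℕ) (l : List ℕ) : Prop :=
  ∀ (i : ℕ) (h : i < l.length), mem (p + i) = l[i]

theorem holds_append {mem : ℕ → ℕ} {p : ℕ} {l l' : List ℕ} :
    Holds mem p (l ++ l') ↔ Holds mem p l ∧ Holds mem (p + l.length) l' := by
  constructor
  · intro h
    refine ⟨fun i hi => ?_, fun i hi => ?_⟩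
    · rw [h i (by simp; omega), List.getElem_append_left hi]
    · rw [add_assoc, h _ (by simp; omega), List.getElem_append_right (by omega)]
      simp
  · rintro ⟨h, h'⟩ i hi
    by_cases hil : i < l.length
    · rw [h i hil, List.getElem_append_left hil]
    · rw [List.getElem_append_right (by omega), ← h']
      congr 1
      omega

theorem holds_nil {mem : ℕ → ℕ} {p : ℕ} : Holds mem p [] := fun _ h => absurd h (by simp)

theorem holds_cons {mem : ℕ → ℕ} {p a : ℕ} {l : List ℕ} :
    Holds mem p (a :: l) ↔ mem p = a ∧ Holds mem (p + 1) l := by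
  rw [← List.singleton_append, holds_append]
  simp [Holds]

theorem Holds.concat {mem : ℕ → ℕ} {p q : ℕ} {l : List ℕ} (h : Holds mem p l)
    (hq : q = p + l.length) (a : ℕ) : Holds (Function.update mem q a) p (l ++ [a]) := by
  subst hq
  refine holds_append.2 ⟨fun i hi => ?_, holds_cons.2 ⟨by simp, holds_nil⟩⟩
  rw [Function.update_of_ne (by omega), h i hi]

theorem Holds.update_of_lt {mem : ℕ → ℕ} {p q : ℕ} {l : List ℕ} (h : Holds mem p l) (hq : q < p)
    (a : ℕ) : Holds (Function.update mem q a) p l := fun i hi => by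
  rw [Function.update_of_ne (by omega), h i hi]

theorem RAMState.holds_init (l : List ℕ) : Holds (RAMState.init l 0) 0 (l.length :: l) := by
  intro i hi
  simp [RAMState.init, List.getElem?_eq_getElem hi]

theorem RAMState.hasOutput_iff {s : RAMState} {l : List ℕ} :
    s.HasOutput l ↔ s 1 0 = l.length ∧ Holds (s 1) 1 l := by
  rw [← zero_add 1, ← holds_cons]
  simp [RAMState.HasOutput, Holds]

theorem FlatEq.holds_enc {mem : ℕ → ℕ} {p : ℕ} {e : FlatEq} :
    Holds mem p e.enc ↔ mem p = e.vars.length ∧ Holds mem (p + 1) e.vars ∧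
      mem (p + e.vars.length + 1) = e.b ∧ mem (p + e.vars.length + 2) = e.w := by
  simp only [FlatEq.enc, List.cons_append, holds_cons, holds_append, holds_nil, and_true,
    show p + 1 + e.vars.length = p + e.vars.length + 1 by omega]

/-! ### Loops over the input -/

/-! The memory banks used by the programs. Bank `0` is the input and bank `1` the output; a bank
whose name is in the singular is used as a register, only its cell `0` being accessed. -/
namespace Bank

/-- Address in the input of the current equation. -/
abbrev eqPtr : ℕ := 2
abbrev eqCounter : ℕ := 3
abbrev varCounter : ℕ := 4
abbrev curVar : ℕ := 5

end Bank

namespace RAMProg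

open Bank

/-- Run the body for every variable of the current equation, which is put into `curVar`. -/
def varLoop (P : RAMProg) : RAMProg :=
  forTo varCounter (.get 0 (.reg eqPtr))
    (setReg curVar (.get 0 (.add (.add (.reg eqPtr) (.const 1)) (.reg varCounter))) ;; P)

/-- Run the body for every equation of the input, whose address is put into `eqPtr`. The input is
its length, the parameter, the numbers of variables and of equations, and the equations, so that the
equations start at address `4`. -/
def eqLoop (P : RAMProg) : RAMProg :=
  setReg eqPtr (.const 4) ;; forTo eqCounter (.get 0 (.const 3))
    (P ;; setReg eqPtr (.add (.add (.reg eqPtr) (.get 0 (.reg eqPtr))) (.const 3)))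

theorem writes_varLoop (P : RAMProg) (b : ℕ) :
    (varLoop P).writes b = (varCounter == b || (curVar == b || P.writes b)) :=
  writes_forTo _ _ _ _

theorem writes_eqLoop (P : RAMProg) (b : ℕ) :
    (eqLoop P).writes b = (eqPtr == b || (eqCounter == b || (P.writes b || eqPtr == b))) := by
  simp only [eqLoop, writes, writes_forTo]

namespace Runs

variable {B : ℕ} {P : RAMProg} {s₀ : RAMState}

theorem varLoop {e : FlatEq} (I : List ℕ → RAMState → Prop) (hB : e.vars.length ≤ B)
    (hs : Holds (s₀ 0) (s₀ eqPtr 0) e.enc) (hw0 : P.writes 0 = false)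
    (hwp : P.writes eqPtr = false) (hwc : P.writes varCounter = false)
    (hst : ∀ l s v, I l s → I l (s.write varCounter 0 v))
    (hst' : ∀ l s v, I l s → I l (s.write curVar 0 v)) (h₀ : I [] s₀)
    (hstep : ∀ l v l' s, e.vars = l ++ v :: l' → Frame (varLoop P) s₀ s → s curVar 0 = v →
      I l s → Runs B P s (I (l ++ [v]))) :
    Runs B (RAMProg.varLoop P) s₀ (I e.vars) := by
  have hwr0 : (RAMProg.varLoop P).writes 0 = false := by simp [writes_varLoop, hw0]
  have hwrp : (RAMProg.varLoop P).writes eqPtr = false := by simp [writes_varLoop, hwp]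
  obtain ⟨hlen, hvars, -⟩ := FlatEq.holds_enc.1 hs
  suffices Runs B (RAMProg.varLoop P) s₀ (I (e.vars.take e.vars.length)) by
    rwa [List.take_length] at this
  refine Runs.forTo (fun j s => I (e.vars.take j) s) hB (by simp [writes, hwc]) ?_
    (fun j s v h => hst _ _ _ h) (by simpa using h₀) ?_
  · intro s hf
    simp only [RAMExpr.eval]
    rw [hf 0 hwr0, hf eqPtr hwrp, hlen]
  · intro j s hj hf hcount hI
    have hsplit : e.vars = e.vars.take j ++ e.vars[j] :: e.vars.drop (j + 1) := by simp
    have hval : (RAMExpr.get 0 (.add (.add (.reg eqPtr) (.const 1)) (.reg varCounter))).eval s =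
        e.vars[j] := by
      simp only [RAMExpr.eval]
      rw [hf 0 hwr0, hf eqPtr hwrp, hcount, hvars j hj]
    refine .seq (.assign ?_)
    rw [hval, List.take_succ_eq_append_getElem hj]
    exact hstep _ _ _ _ hsplit (Frame.write hf (by simp [writes_forTo, writes]) _ _)
      (by simp [RAMExpr.eval]) (hst' _ _ _ hI)

theorem advance_eqPtr {e : FlatEq} {J Q : RAMState → Prop} {s : RAMState} {p : ℕ}
    (hp : s eqPtr 0 = p) (he : Holds (s 0) p e.enc) (hw0 : P.writes 0 = false)
    (hwp : P.writes eqPtr = false) (hP : Runs B P s J)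
    (hQ : ∀ s', J s' → Q (s'.write eqPtr 0 (p + e.enc.length))) :
    Runs B (P ;; setReg eqPtr (.add (.add (.reg eqPtr) (.get 0 (.reg eqPtr))) (.const 3))) s Q := by
  refine .seq (hP.mono fun s' hf hJ => .assign ?_)
  have hval : (RAMExpr.add (.add (.reg eqPtr) (.get 0 (.reg eqPtr))) (.const 3)).eval s' =
      p + e.enc.length := by
    simp only [RAMExpr.eval]
    rw [hf eqPtr hwp, hf 0 hw0, hp, (FlatEq.holds_enc.1 he).1]
    simp [FlatEq.enc]
    omega
  rw [hval]
  exact hQ s' hJ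

theorem eqLoop {eqs : List FlatEq} (I : List FlatEq → RAMState → Prop) (hB : eqs.length ≤ B)
    (hm : s₀ 0 3 = eqs.length) (hs : Holds (s₀ 0) 4 (eqs.flatMap FlatEq.enc))
    (hw0 : P.writes 0 = false) (hwp : P.writes eqPtr = false) (hwc : P.writes eqCounter = false)
    (hst : ∀ l s v, I l s → I l (s.write eqPtr 0 v))
    (hst' : ∀ l s v, I l s → I l (s.write eqCounter 0 v)) (h₀ : I [] s₀)
    (hstep : ∀ l e l' s, eqs = l ++ e :: l' → Frame (eqLoop P) s₀ s →
      Holds (s 0) (s eqPtr 0) e.enc → I l s → Runs B P s (I (l ++ [e]))) :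
    Runs B (RAMProg.eqLoop P) s₀ (I eqs) := by
  have hwr0 : (RAMProg.eqLoop P).writes 0 = false := by simp [writes_eqLoop, hw0]
  have hframe {s : RAMState} (hf : Frame _ (s₀.write eqPtr 0 4) s) :
      Frame (RAMProg.eqLoop P) s₀ s :=
    ((Frame.refl _ _).write (by simp [writes_eqLoop]) 0 4).trans (hf.mono fun b hb => by
      rw [RAMProg.eqLoop, writes, Bool.or_eq_false_iff] at hb
      exact hb.2)
  suffices Runs B (RAMProg.eqLoop P) s₀ fun s =>
      s eqPtr 0 = 4 + ((eqs.take eqs.length).flatMap FlatEq.enc).length ∧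
        I (eqs.take eqs.length) s from
    this.mono fun s _ h => by simpa using h.2
  refine .seq (.assign (Runs.forTo (fun j s =>
    s eqPtr 0 = 4 + ((eqs.take j).flatMap FlatEq.enc).length ∧ I (eqs.take j) s) hB
    (by simp [writes, hwc]) ?_ ?_
    ⟨by simp [RAMExpr.eval], by simpa [RAMExpr.eval] using hst _ _ 4 h₀⟩ ?_))
  · intro s hf
    simp only [RAMExpr.eval]
    rw [hframe hf 0 hwr0, hm]
  · rintro j s v ⟨hp, hI⟩
    exact ⟨by simpa using hp, hst' _ _ _ hI⟩
  · rintro j s hj hf - ⟨hp, hI⟩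
    have hsplit : eqs = eqs.take j ++ eqs[j] :: eqs.drop (j + 1) := by simp
    have he : Holds (s 0) (s eqPtr 0) eqs[j].enc := by
      rw [hframe hf 0 hwr0, hp]
      rw [hsplit, List.flatMap_append, holds_append, List.flatMap_cons, holds_append] at hs
      exact hs.2.1
    refine advance_eqPtr hp (hp ▸ he) hw0 hwp (hstep _ _ _ _ hsplit (hframe hf) he hI) ?_
    intro s' hI'
    rw [List.take_succ_eq_append_getElem hj, List.flatMap_append, List.length_append,
      List.flatMap_singleton, ← add_assoc]
    exact ⟨by simp, hst _ _ _ hI'⟩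

end Runs

end RAMProg

/-! ### Analysis of the input -/

/-- The variables that occur in the equations, in the order of their first occurrences. -/
def allVars (eqs : List FlatEq) : List ℕ := firstOccs id (eqs.flatMap FlatEq.vars)

theorem mem_allVars {eqs : List FlatEq} {e : FlatEq} (he : e ∈ eqs) {v : ℕ} (hv : v ∈ e.vars) :
    v ∈ allVars eqs :=
  mem_firstOccs_id.2 (List.mem_flatMap.2 ⟨e, he, hv⟩)

theorem length_allVars_le (eqs : List FlatEq) :
    (allVars eqs).length ≤ (eqs.flatMap FlatEq.vars).length :=
  (firstOccs_sublist _ _).length_le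

theorem length_essentialVars_le (eqs : List FlatEq) :
    (essentialVars eqs eqs).length ≤ (allVars eqs).length := by
  refine ((nodup_essentialVars eqs eqs).subperm fun v hv => ?_).length_le
  obtain ⟨e, he, -, hv⟩ := mem_essentialVars.1 hv
  exact mem_allVars he hv

namespace FlatEq

/-- A number that determines the set of variables of an equation. The programs use it as an address
in order to compare sets of variables in constant time. -/
def key (D : List ℕ) (e : FlatEq) : ℕ := (e.vars.map fun v => 2 ^ label D v).sum

theorem key_eq_sum {D : List ℕ} {e : FlatEq} (he : e.vars.Nodup) (hD : ∀ v ∈ e.vars, v ∈ D) :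
    e.key D = ∑ i ∈ e.varSet.image (label D), 2 ^ i := by
  rw [Finset.sum_image, varSet, List.sum_toFinset _ he, key]
  exact (label_injOn D).mono fun v hv => hD v (mem_varSet.1 hv)

theorem key_eq_iff {D : List ℕ} {e e' : FlatEq} (he : e.vars.Nodup) (he' : e'.vars.Nodup)
    (hD : ∀ v ∈ e.vars, v ∈ D) (hD' : ∀ v ∈ e'.vars, v ∈ D) :
    e.key D = e'.key D ↔ e.varSet = e'.varSet := by
  rw [key_eq_sum he hD, key_eq_sum he' hD', (Finset.geomSum_injective le_rfl).eq_iff,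
    ← Finset.coe_inj, Finset.coe_image, Finset.coe_image, (label_injOn D).image_eq_image_iff
      (fun v hv => hD v (mem_varSet.1 hv)) (fun v hv => hD' v (mem_varSet.1 hv)), Finset.coe_inj]

theorem key_allVars_eq_iff {eqs : List FlatEq} (hl : ∀ e ∈ eqs, e.vars.Nodup) {e e' : FlatEq}
    (he : e ∈ eqs) (he' : e' ∈ eqs) :
    e.key (allVars eqs) = e'.key (allVars eqs) ↔ e.varSet = e'.varSet :=
  key_eq_iff (hl e he) (hl e' he') (fun _ => mem_allVars he) (fun _ => mem_allVars he')

end FlatEq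

/-- The total weight of the equations on which `φ` takes the value `a` and whose right-hand side
satisfies `p`. -/
def weightOn (φ : FlatEq → ℕ) (p : ℕ → Bool) (l : List FlatEq) (a : ℕ) : ℕ :=
  ((l.filter fun e => φ e = a && p e.b).map FlatEq.w).sum

theorem weightOn_concat (φ : FlatEq → ℕ) (p : ℕ → Bool) (l : List FlatEq) (e : FlatEq) :
    weightOn φ p (l ++ [e]) = if p e.b then
      Function.update (weightOn φ p l) (φ e) (weightOn φ p l (φ e) + e.w) else weightOn φ p l := by
  ext a
  by_cases hp : p e.b
  · by_cases ha : a = φ e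
    · subst ha
      simp [weightOn, hp]
    · simp [weightOn, hp, ha, Ne.symm ha]
  · simp [weightOn, hp]

theorem weightOn_sub_weightOn (φ : FlatEq → ℕ) (l : List FlatEq) (a : ℕ) :
    (weightOn φ (· == 0) l a : ℤ) - weightOn φ (· != 0) l a = fiberWeight φ l a := by
  induction l with
  | nil => simp [weightOn, fiberWeight]
  | cons e l ih =>
    rw [fiberWeight_cons, ← ih]
    by_cases ha : φ e = a <;> by_cases hb : e.b = 0 <;>
      simp [weightOn, FlatEq.signedWeight, ha, hb] <;> ring

/-- The memory bank holds the parameter and the equations, and `B` bounds their number and the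
number of occurrences of variables. -/
structure Loaded (B k : ℕ) (eqs : List FlatEq) (mem : ℕ → ℕ) : Prop where
  param : mem 1 = k
  count : mem 3 = eqs.length
  holds : Holds mem 4 (eqs.flatMap FlatEq.enc)
  length_le : eqs.length ≤ B
  occs_le : (eqs.flatMap FlatEq.vars).length ≤ B

theorem Loaded.vars_length_le {B k : ℕ} {eqs : List FlatEq} {mem : ℕ → ℕ}
    (h : Loaded B k eqs mem) {e : FlatEq} (he : e ∈ eqs) : e.vars.length ≤ B := by
  refine le_trans ?_ h.occs_le
  rw [List.length_flatMap]
  exact List.single_le_sum (by simp) _ (List.mem_map_of_mem he)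

namespace Bank

abbrev labels : ℕ := 6
abbrev numLabels : ℕ := 7
/-- Table of the powers of two. -/
abbrev pows : ℕ := 8
abbrev counter : ℕ := 9
/-- Key of the current equation. -/
abbrev key : ℕ := 10
/-- Total weight, for every key, of the equations with right-hand side `0`. -/
abbrev posWeight : ℕ := 11
/-- Total weight, for every key, of the equations with right-hand side `1`. -/
abbrev negWeight : ℕ := 12
/-- Labels of the variables of equations with nonzero net weight. -/
abbrev essLabels : ℕ := 13
abbrev numEss : ℕ := 14
/-- Nonzero if some net weight is at least the parameter in absolute value. -/
abbrev yesFlag : ℕ := 15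

end Bank

open Bank

namespace RAMExpr

/-- The right-hand side of the current equation. -/
def curRhs : RAMExpr := .get 0 (.add (.add (.reg eqPtr) (.get 0 (.reg eqPtr))) (.const 1))

/-- The weight of the current equation. -/
def curWeight : RAMExpr := .get 0 (.add (.add (.reg eqPtr) (.get 0 (.reg eqPtr))) (.const 2))

/-- The absolute value of the net weight for the current key. -/
def absNetWeight : RAMExpr :=
  .add (.sub (.get posWeight (.reg key)) (.get negWeight (.reg key)))
    (.sub (.get negWeight (.reg key)) (.get posWeight (.reg key)))

theorem eval_curRhs {s : RAMState} {e : FlatEq} (h : Holds (s 0) (s eqPtr 0) e.enc) :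
    curRhs.eval s = e.b := by
  obtain ⟨hlen, -, hb, -⟩ := FlatEq.holds_enc.1 h
  simp only [curRhs, RAMExpr.eval]
  rw [hlen, hb]

theorem eval_curWeight {s : RAMState} {e : FlatEq} (h : Holds (s 0) (s eqPtr 0) e.enc) :
    curWeight.eval s = e.w := by
  obtain ⟨hlen, -, -, hw⟩ := FlatEq.holds_enc.1 h
  simp only [curWeight, RAMExpr.eval]
  rw [hlen, hw]

end RAMExpr

/-- The variables in `L` are labelled in the bank `lab`, and the register `N` counts the labels. -/
structure Registered (lab N : ℕ) (L : List ℕ) (s : RAMState) : Prop where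
  labels : s lab = label (firstOccs id L)
  count : s N 0 = (firstOccs id L).length

namespace Registered

variable {lab N : ℕ} {L : List ℕ} {s s' : RAMState}

theorem congr (h : Registered lab N L s) (hlab : s' lab = s lab) (hN : s' N = s N) :
    Registered lab N L s' :=
  ⟨hlab ▸ h.labels, hN ▸ h.count⟩

theorem write (h : Registered lab N L s) {b : ℕ} (hlab : lab ≠ b) (hN : N ≠ b) (a v : ℕ) :
    Registered lab N L (s.write b a v) :=
  h.congr (s.write_of_ne a v hlab) (s.write_of_ne a v hN)

theorem nil (hlab : s lab = 0) (hN : s N = 0) : Registered lab N [] s :=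
  ⟨hlab, by rw [hN]; rfl⟩

end Registered

namespace RAMProg

/-- Give the variable in `curVar` a label in the bank `lab`, unless it has one; the register `N`
counts the labels. -/
def registerVar (lab N : ℕ) : RAMProg :=
  .cond (.get lab (.reg curVar)) .skip
    (setReg N (.add (.reg N) (.const 1)) ;; .assign lab (.reg curVar) (.reg N))

/-- Compute the labels of all variables. -/
def labelPass : RAMProg := eqLoop (varLoop (registerVar labels numLabels))

/-- Compute the powers of two up to the number of labels. -/
def powPass : RAMProg :=
  .assign pows (.const 0) (.const 1) ;; forTo counter (.reg numLabels)
    (.assign pows (.add (.reg counter) (.const 1))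
      (.add (.get pows (.reg counter)) (.get pows (.reg counter))))

/-- Compute the key of the current equation. -/
def computeKey : RAMProg :=
  setReg key (.const 0) ;;
    varLoop (setReg key (.add (.reg key) (.get pows (.get labels (.reg curVar)))))

/-- Compute the total weights of the equations with the same variables and right-hand side. -/
def weightPass : RAMProg :=
  eqLoop (computeKey ;; .cond .curRhs
    (.assign negWeight (.reg key) (.add (.get negWeight (.reg key)) .curWeight))
    (.assign posWeight (.reg key) (.add (.get posWeight (.reg key)) .curWeight)))

/-- Label the variables of the current equation if its net weight is nonzero. -/
def registerEssential : RAMProg :=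
  .cond .absNetWeight (varLoop (registerVar essLabels numEss)) .skip

/-- Raise the flag if the net weight of the current equation is large. -/
def flagLarge : RAMProg :=
  .cond (.sub (.add .absNetWeight (.const 1)) (.get 0 (.const 1))) (setReg yesFlag (.const 1)) .skip

/-- Compute the labels of the essential variables and the flag. -/
def essentialPass : RAMProg := eqLoop (computeKey ;; registerEssential ;; flagLarge)

/-- The complete analysis of the input. -/
def analysis : RAMProg := labelPass ;; powPass ;; weightPass ;; essentialPass

end RAMProg

/-- The tables of labels, powers of two and weights are set up. -/
structure Tables (eqs : List FlatEq) (s : RAMState) : Prop where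
  labels : s labels = label (allVars eqs)
  pows : ∀ i ≤ (allVars eqs).length, s pows i = 2 ^ i
  pos : s posWeight = weightOn (FlatEq.key (allVars eqs)) (· == 0) eqs
  neg : s negWeight = weightOn (FlatEq.key (allVars eqs)) (· != 0) eqs

/-- The tables are set up and the current equation is `e`. -/
structure AtEquation (eqs : List FlatEq) (e : FlatEq) (s : RAMState) : Prop
    extends Tables eqs s where
  holds : Holds (s 0) (s eqPtr 0) e.enc
  key : s key 0 = e.key (allVars eqs)

/-- The result of the analysis. -/
structure Analyzed (k : ℕ) (eqs : List FlatEq) (s : RAMState) : Prop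
    extends Tables eqs s where
  essLabels : s essLabels = label (essentialVars eqs eqs)
  numEss : s numEss 0 = (essentialVars eqs eqs).length
  yesFlag : s yesFlag 0 = 0 ↔ ∀ e ∈ eqs, (netWeight eqs e).natAbs < k

section Invariants

open RAMProg

variable {eqs : List FlatEq} {e : FlatEq} {P : RAMProg} {s s' : RAMState}

theorem Tables.frame (h : Tables eqs s) (hf : Frame P s s')
    (hw : ∀ b ∈ [Bank.labels, Bank.pows, posWeight, negWeight], P.writes b = false) :
    Tables eqs s' := by
  simp only [List.forall_mem_cons] at hw
  obtain ⟨h₁, h₂, h₃, h₄, -⟩ := hw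
  exact ⟨hf _ h₁ ▸ h.labels, hf _ h₂ ▸ h.pows, hf _ h₃ ▸ h.pos, hf _ h₄ ▸ h.neg⟩

theorem AtEquation.frame (h : AtEquation eqs e s) (hf : Frame P s s')
    (hw : ∀ b ∈ [0, eqPtr, Bank.key, labels, pows, posWeight, negWeight],
      P.writes b = false) :
    AtEquation eqs e s' := by
  rw [List.forall_mem_cons, List.forall_mem_cons, List.forall_mem_cons] at hw
  obtain ⟨h₁, h₂, h₃, h₄⟩ := hw
  exact ⟨h.toTables.frame hf h₄, by rw [hf _ h₁, hf _ h₂]; exact h.holds, hf _ h₃ ▸ h.key⟩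

theorem AtEquation.weight_sub_weight (h : AtEquation eqs e s) (hl : ∀ e ∈ eqs, e.vars.Nodup)
    (he : e ∈ eqs) :
    (s posWeight (s Bank.key 0) : ℤ) - s negWeight (s Bank.key 0) = netWeight eqs e := by
  rw [h.key, h.pos, h.neg, weightOn_sub_weightOn]
  exact fiberWeight_congr fun e' he' => FlatEq.key_allVars_eq_iff hl he' he

theorem AtEquation.eval_absNetWeight (h : AtEquation eqs e s) (hl : ∀ e ∈ eqs, e.vars.Nodup)
    (he : e ∈ eqs) : RAMExpr.absNetWeight.eval s = (netWeight eqs e).natAbs := by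
  rw [← h.weight_sub_weight hl he]
  simp only [RAMExpr.absNetWeight, RAMExpr.eval]
  omega

end Invariants

namespace RAMProg

variable {B k : ℕ} {eqs : List FlatEq} {s : RAMState} {D : List ℕ} {e : FlatEq}

theorem runs_registerVar {lab N : ℕ} {L : List ℕ} (hlab : lab ≠ N) (hN : N ≠ curVar)
    (h : Registered lab N L s) :
    Runs B (registerVar lab N) s (Registered lab N (L ++ [s curVar 0])) := by
  have htest : (RAMExpr.get lab (.reg curVar)).eval s ≠ 0 ↔ s curVar 0 ∈ L := by
    rw [← mem_firstOccs_id, ← label_ne_zero_iff, ← h.labels]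
    rfl
  refine .cond (fun h0 => .skip ?_) fun h0 => .seq (.assign (.assign ?_))
  · have hmem : id (s curVar 0) ∈ L.map id := by rwa [List.map_id, id, ← htest]
    exact ⟨by rw [firstOccs_concat_of_mem hmem, h.labels],
      by rw [firstOccs_concat_of_mem hmem, h.count]⟩
  · have hmem : s curVar 0 ∉ firstOccs id L := by rwa [mem_firstOccs_id, ← htest, not_not]
    have hocc := firstOccs_concat_of_notMem (f := id) (L := L) (a := s curVar 0)
      (by rwa [List.map_id, id, ← mem_firstOccs_id])
    constructor
    · rw [hocc, label_concat hmem, ← h.count, ← h.labels]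
      simp [RAMExpr.eval, hlab, hN.symm]
    · rw [hocc, List.length_append, ← h.count]
      simp [RAMExpr.eval, hlab.symm]

theorem runs_registerVars {lab N : ℕ} {L : List ℕ} (hB : e.vars.length ≤ B)
    (hs : Holds (s 0) (s eqPtr 0) e.enc) (hlab : lab ≠ N)
    (hne : ∀ b ∈ [0, eqPtr, varCounter, curVar], lab ≠ b ∧ N ≠ b) (h : Registered lab N L s) :
    Runs B (varLoop (registerVar lab N)) s (Registered lab N (L ++ e.vars)) := by
  simp only [List.forall_mem_cons, List.not_mem_nil, false_implies, implies_true, and_true] at hne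
  obtain ⟨⟨hlab₀, hN₀⟩, ⟨hlab₁, hN₁⟩, ⟨hlab₂, hN₂⟩, hlab₃, hN₃⟩ := hne
  refine Runs.varLoop (fun vs => Registered lab N (L ++ vs)) hB hs
    (by simp [registerVar, writes, hlab₀, hN₀]) (by simp [registerVar, writes, hlab₁, hN₁])
    (by simp [registerVar, writes, hlab₂, hN₂]) (fun _ _ _ hI => hI.write hlab₂ hN₂ _ _)
    (fun _ _ _ hI => hI.write hlab₃ hN₃ _ _) (by rwa [List.append_nil]) ?_
  rintro vs v vs' s' - - hv hI
  rw [← List.append_assoc, ← hv]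
  exact runs_registerVar hlab hN₃ hI

theorem runs_labelPass (h : Loaded B k eqs (s 0)) (hlab : s labels = 0) (hN : s numLabels = 0) :
    Runs B labelPass s (Registered labels numLabels (eqs.flatMap FlatEq.vars)) := by
  refine Runs.eqLoop (fun l => Registered labels numLabels (l.flatMap FlatEq.vars)) h.length_le
    h.count h.holds rfl rfl rfl (fun _ _ _ hI => hI.write (by decide) (by decide) _ _)
    (fun _ _ _ hI => hI.write (by decide) (by decide) _ _) (.nil hlab hN) ?_
  rintro l e l' s' rfl - hs hI
  rw [List.flatMap_append, List.flatMap_singleton]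
  exact runs_registerVars (h.vars_length_le (by simp)) hs (by decide) (by decide) hI

theorem runs_powPass {n : ℕ} (hn : n ≤ B) (hN : s numLabels 0 = n) :
    Runs B powPass s fun s' => ∀ i ≤ n, s' pows i = 2 ^ i := by
  refine .seq (.assign (Runs.forTo (fun j s => ∀ i ≤ j, s pows i = 2 ^ i) hn rfl ?_
    (fun j s v h => by simpa using h) (by simp [RAMExpr.eval]) ?_))
  · intro s' hf
    simpa [RAMExpr.eval, hf numLabels rfl] using hN
  · rintro j s' - - hcount hI
    refine .assign fun i hi => ?_
    rcases Nat.lt_or_eq_of_le hi with hi | rfl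
    · have hne : i ≠ j + 1 := by omega
      simpa [RAMExpr.eval, hcount, hne] using hI i (by omega)
    · simp [RAMExpr.eval, hcount, hI j le_rfl, pow_succ, mul_two]

theorem runs_computeKey (hB : e.vars.length ≤ B) (hs : Holds (s 0) (s eqPtr 0) e.enc)
    (hlab : s labels = label D) (hpow : ∀ i ≤ D.length, s pows i = 2 ^ i) :
    Runs B computeKey s fun s' => s' key 0 = e.key D := by
  refine .seq (.assign (Runs.varLoop
    (fun vs s => s key 0 = (vs.map fun v => 2 ^ label D v).sum) hB
    (by simpa [RAMExpr.eval] using hs) rfl rfl rfl (fun l s v h => by simpa using h)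
    (fun l s v h => by simpa using h) (by simp [RAMExpr.eval]) ?_))
  rintro vs v vs' s' - hf hv hI
  have hlab' : s' labels = label D := by simpa [hf labels rfl] using hlab
  have hpow' : s' pows = s pows := by simp [hf pows rfl]
  refine .assign ?_
  simp [RAMExpr.eval, hv, hI, hlab', hpow', hpow _ (label_le D v)]

theorem runs_weightPass (h : Loaded B k eqs (s 0)) (hlab : s labels = label D)
    (hpow : ∀ i ≤ D.length, s pows i = 2 ^ i) (hpos : s posWeight = 0) (hneg : s negWeight = 0) :
    Runs B weightPass s fun s' => s' posWeight = weightOn (FlatEq.key D) (· == 0) eqs ∧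
      s' negWeight = weightOn (FlatEq.key D) (· != 0) eqs := by
  refine Runs.eqLoop (fun l s => s posWeight = weightOn (FlatEq.key D) (· == 0) l ∧
    s negWeight = weightOn (FlatEq.key D) (· != 0) l) h.length_le h.count h.holds rfl rfl rfl
    (fun l s v h => by simpa using h) (fun l s v h => by simpa using h)
    ⟨by rw [hpos]; rfl, by rw [hneg]; rfl⟩ ?_
  rintro l e l' s₁ rfl hf₁ hs hI
  refine .seq ((runs_computeKey (h.vars_length_le (by simp)) hs ((hf₁ labels rfl).trans hlab)
    (hf₁ pows rfl ▸ hpow)).mono fun s₂ hf₂ hkey => ?_)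
  have hs₂ : Holds (s₂ 0) (s₂ eqPtr 0) e.enc := by rwa [hf₂ 0 rfl, hf₂ eqPtr rfl]
  rw [← hf₂ posWeight rfl, ← hf₂ negWeight rfl] at hI
  refine .cond (fun hb => .assign ?_) fun hb => .assign ?_
  all_goals
    rw [RAMExpr.eval_curRhs hs₂] at hb
    simp [RAMExpr.eval, RAMExpr.eval_curWeight hs₂, weightOn_concat, hb, hkey, hI]

theorem runs_computeKey_atEquation (hB : e.vars.length ≤ B) (ht : Tables eqs s)
    (hs : Holds (s 0) (s eqPtr 0) e.enc) : Runs B computeKey s (AtEquation eqs e) :=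
  (runs_computeKey hB hs ht.labels ht.pows).mono fun s' hf hkey =>
    ⟨ht.frame hf (by decide), by rwa [hf 0 rfl, hf eqPtr rfl], hkey⟩

theorem runs_registerEssential {l : List FlatEq} (hB : e.vars.length ≤ B)
    (hl : ∀ e ∈ eqs, e.vars.Nodup) (he : e ∈ eqs) (hs : AtEquation eqs e s)
    (h : Registered essLabels numEss ((essentialEqs eqs l).flatMap FlatEq.vars) s) :
    Runs B registerEssential s
      (Registered essLabels numEss ((essentialEqs eqs (l ++ [e])).flatMap FlatEq.vars)) := by
  refine .cond (fun h0 => ?_) fun h0 => .skip ?_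
  · rw [hs.eval_absNetWeight hl he, Int.natAbs_ne_zero] at h0
    have := runs_registerVars hB hs.holds (by decide) (by decide) h
    simpa [essentialEqs, h0] using this
  · rw [hs.eval_absNetWeight hl he, Int.natAbs_eq_zero] at h0
    simpa [essentialEqs, h0] using h

theorem runs_flagLarge {l : List FlatEq} (hl : ∀ e ∈ eqs, e.vars.Nodup) (he : e ∈ eqs)
    (hs : AtEquation eqs e s) (hk : s 0 1 = k)
    (h : s yesFlag 0 = 0 ↔ ∀ e ∈ l, (netWeight eqs e).natAbs < k) :
    Runs B flagLarge s fun s' =>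
      s' yesFlag 0 = 0 ↔ ∀ e' ∈ l ++ [e], (netWeight eqs e').natAbs < k := by
  have hval : (RAMExpr.sub (.add .absNetWeight (.const 1)) (.get 0 (.const 1))).eval s =
      (netWeight eqs e).natAbs + 1 - k := by
    simp [RAMExpr.eval, hs.eval_absNetWeight hl he, hk]
  simp only [List.forall_mem_append, List.forall_mem_singleton]
  refine .cond (fun h0 => .assign ?_) fun h0 => .skip ?_
  · rw [hval] at h0
    have hlarge : ¬ (netWeight eqs e).natAbs < k := by omega
    simp [RAMExpr.eval, hlarge]
  · rw [hval] at h0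
    have hsmall : (netWeight eqs e).natAbs < k := by omega
    simp [h, hsmall]

theorem runs_essentialPass (h : Loaded B k eqs (s 0)) (hl : ∀ e ∈ eqs, e.vars.Nodup)
    (ht : Tables eqs s) (hlab : s essLabels = 0) (hN : s numEss = 0) (hflag : s yesFlag = 0) :
    Runs B essentialPass s (Analyzed k eqs) := by
  refine .mono (Q := fun s =>
    Registered essLabels numEss ((essentialEqs eqs eqs).flatMap FlatEq.vars) s ∧
      (s yesFlag 0 = 0 ↔ ∀ e ∈ eqs, (netWeight eqs e).natAbs < k)) ?_ fun s' hf h' =>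
    ⟨ht.frame hf (by decide), h'.1.labels, h'.1.count, h'.2⟩
  refine Runs.eqLoop (fun l s =>
    Registered essLabels numEss ((essentialEqs eqs l).flatMap FlatEq.vars) s ∧
      (s yesFlag 0 = 0 ↔ ∀ e ∈ l, (netWeight eqs e).natAbs < k))
    h.length_le h.count h.holds rfl rfl rfl
    (fun l s v h => ⟨h.1.write (by decide) (by decide) _ _, by simpa using h.2⟩)
    (fun l s v h => ⟨h.1.write (by decide) (by decide) _ _, by simpa using h.2⟩)
    ⟨.nil hlab hN, by simp [hflag]⟩ ?_
  rintro l e l' s₁ hel hf₁ hs ⟨hreg, hyes⟩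
  have he : e ∈ eqs := by simp [hel]
  refine .seq ((runs_computeKey_atEquation (h.vars_length_le he)
    (ht.frame hf₁ (by decide)) hs).mono fun s₂ hf₂ hs₂ => ?_)
  refine .seq ((runs_registerEssential (h.vars_length_le he) hl he hs₂
    (hreg.congr (hf₂ _ rfl) (hf₂ _ rfl))).mono fun s₃ hf₃ hreg₃ => ?_)
  have hk : s₃ 0 1 = k := by rw [hf₃ 0 rfl, hf₂ 0 rfl, hf₁ 0 rfl, h.param]
  rw [← hf₂ yesFlag rfl, ← hf₃ yesFlag rfl] at hyes
  exact (runs_flagLarge hl he (hs₂.frame hf₃ (by decide)) hk hyes).mono fun s₄ hf₄ hyes₄ =>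
    ⟨hreg₃.congr (hf₄ _ rfl) (hf₄ _ rfl), hyes₄⟩

theorem runs_analysis (h : Loaded B k eqs (s 0)) (hl : ∀ e ∈ eqs, e.vars.Nodup)
    (hzero : ∀ b ≠ 0, s b = 0) : Runs B analysis s (Analyzed k eqs) := by
  have hD : (allVars eqs).length ≤ B := (length_allVars_le eqs).trans h.occs_le
  refine .seq ((runs_labelPass h (hzero _ (by decide)) (hzero _ (by decide))).mono
    fun s₁ hf₁ hreg => .seq ((runs_powPass hD hreg.count).mono fun s₂ hf₂ hpow => ?_))
  have hlab₂ : s₂ labels = label (allVars eqs) := (hf₂ labels rfl).trans hreg.labels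
  have h₂ : Loaded B k eqs (s₂ 0) := by rwa [hf₂ 0 rfl, hf₁ 0 rfl]
  have hzero₂ (b : ℕ) (hb : b ≠ 0) (hb₁ : labelPass.writes b = false)
      (hb₂ : powPass.writes b = false) : s₂ b = 0 := by rw [hf₂ b hb₂, hf₁ b hb₁, hzero b hb]
  refine .seq ((runs_weightPass h₂ hlab₂ hpow (hzero₂ _ (by decide) rfl rfl)
    (hzero₂ _ (by decide) rfl rfl)).mono fun s₃ hf₃ hweight => ?_)
  have ht : Tables eqs s₃ :=
    ⟨(hf₃ labels rfl).trans hlab₂, hf₃ pows rfl ▸ hpow, hweight.1, hweight.2⟩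
  refine runs_essentialPass (hf₃ 0 rfl ▸ h₂) hl ht ?_ ?_ ?_
  · rw [hf₃ _ rfl, hzero₂ _ (by decide) rfl rfl]
  · rw [hf₃ _ rfl, hzero₂ _ (by decide) rfl rfl]
  · rw [hf₃ _ rfl, hzero₂ _ (by decide) rfl rfl]

end RAMProg

/-! ### Exhaustive search over the essential variables -/

namespace Bank

/-- The current assignment: values in `{0, 1}` by the labels of the essential variables. -/
abbrev assignment : ℕ := 16
/-- Number of the current assignment, whose binary digits are its values. -/
abbrev assignmentIdx : ℕ := 17
abbrev numAssignments : ℕ := 18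
/-- The part of `assignmentIdx` that consists of the digits not yet extracted. -/
abbrev rest : ℕ := 19
abbrev digit : ℕ := 20
abbrev parity : ℕ := 21
/-- Total weight of the equations satisfied by the current assignment. -/
abbrev satWeight : ℕ := 22
/-- Total weight of the equations falsified by the current assignment. -/
abbrev falseWeight : ℕ := 23
abbrev answer : ℕ := 24

end Bank

namespace RAMExpr

/-- A multiple of an expression. -/
def smul : ℕ → RAMExpr → RAMExpr
  | 0, _ => .const 0
  | c + 1, e => .add (smul c e) e

theorem eval_smul (c : ℕ) (e : RAMExpr) (s : RAMState) : (smul c e).eval s = c * e.eval s := by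
  induction c with
  | zero => simp [smul, eval]
  | succ c ih => simp [smul, eval, ih, Nat.succ_mul]

/-- The absolute difference of two expressions. -/
def dist (e₁ e₂ : RAMExpr) : RAMExpr := .add (.sub e₁ e₂) (.sub e₂ e₁)

/-- Nonzero if the analysis already shows that the parameter is attained: some net weight is large,
or there are at least `2 * r * k` essential variables. -/
def triviallyYes (r : ℕ) : RAMExpr :=
  .add (.reg yesFlag)
    (.sub (.add (.reg numEss) (.const 1)) (.smul (2 * r) (.get 0 (.const 1))))

end RAMExpr

theorem Analyzed.eval_triviallyYes_eq_zero_iff {k r : ℕ} {eqs : List FlatEq} {s : RAMState}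
    (h : Analyzed k eqs s) (hk : s 0 1 = k) : (RAMExpr.triviallyYes r).eval s = 0 ↔
      (∀ e ∈ eqs, (netWeight eqs e).natAbs < k) ∧ (essentialVars eqs eqs).length < 2 * r * k := by
  rw [← h.yesFlag]
  simp only [RAMExpr.triviallyYes, RAMExpr.eval, RAMExpr.eval_smul, h.numEss, hk]
  omega

theorem Analyzed.attainsExcess_of_eval_triviallyYes_ne_zero {k r n : ℕ} {eqs : List FlatEq}
    {s : RAMState} (h : Analyzed k eqs s) (hk : s 0 1 = k) (hl : ∀ e ∈ eqs, e.Valid r n)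
    (hr : 0 < r) (hyes : (RAMExpr.triviallyYes r).eval s ≠ 0) : AttainsExcess eqs k := by
  rw [Ne, h.eval_triviallyYes_eq_zero_iff hk, not_and_or] at hyes
  rcases hyes with hlarge | hmany
  · push Not at hlarge
    obtain ⟨e, he, hle⟩ := hlarge
    refine attainsExcess_of_le_abs_netWeight hl he ?_
    rw [Int.abs_eq_natAbs]
    exact_mod_cast hle
  · exact attainsExcess_of_cover hl hr (nodup_essentialVars eqs eqs)
      (fun v hv => mem_essentialVars.1 hv) (not_lt.1 hmany)

/-- The element of `{0, 1}` that corresponds to a sign. -/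
def signBit (u : ℤˣ) : ℕ := if u = 1 then 0 else 1

theorem signBit_mul (u v : ℤˣ) :
    signBit (u * v) = (signBit u - signBit v) + (signBit v - signBit u) := by
  revert u v
  decide

theorem FlatEq.signedWeight_mul_sign {e : FlatEq} (hb : e.b < 2) (u : ℤˣ) :
    e.signedWeight * (u : ℤ) = if signBit u = e.b then (e.w : ℤ) else -e.w := by
  obtain hb | hb : e.b = 0 ∨ e.b = 1 := by omega
  all_goals rcases Int.units_eq_one_or u with rfl | rfl <;> simp [signedWeight, signBit, hb]

theorem signExcess_concat (l : List FlatEq) (e : FlatEq) (x : ℕ → ℤˣ) :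
    signExcess (l ++ [e]) x =
      signExcess l x + e.signedWeight * ((e.vars.map x).prod : ℤˣ).val := by
  simp [signExcess]

/-- The assignment given by the binary digits of `a` at the labels with respect to `D`. -/
def digitSigns (D : List ℕ) (a v : ℕ) : ℤˣ :=
  if label D v ≠ 0 ∧ a.testBit (label D v - 1) then -1 else 1

theorem attainsExcess_iff_exists_digitSigns {eqs : List FlatEq} (hl : ∀ e ∈ eqs, e.vars.Nodup)
    {k : ℕ} : AttainsExcess eqs k ↔ ∃ a < 2 ^ (essentialVars eqs eqs).length,
      (k : ℤ) ≤ signExcess eqs (digitSigns (essentialVars eqs eqs) a) := by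
  refine ⟨?_, fun ⟨a, _, hk⟩ => ⟨_, hk⟩⟩
  rintro ⟨x, hk⟩
  let bits : Fin (essentialVars eqs eqs).length → Bool := fun i => x (essentialVars eqs eqs)[i] ≠ 1
  refine ⟨Nat.ofBits bits, Nat.ofBits_lt_two_pow bits, hk.trans_eq ?_⟩
  refine signExcess_congr hl fun e he hne v hv => ?_
  have hmem : v ∈ essentialVars eqs eqs := mem_essentialVars.2 ⟨e, he, hne, hv⟩
  have hlt := List.idxOf_lt_length_of_mem hmem
  rcases Int.units_eq_one_or (x v) with h | h <;>
    simp [digitSigns, label, hmem, Nat.testBit_ofBits_lt _ _ hlt, bits, h]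

namespace RAMProg

/-- Move the binary digit with index `digit` from `rest` to the assignment, provided that it is the
leading one. -/
def extractDigit : RAMProg :=
  .cond (.sub (.add (.reg rest) (.const 1)) (.get pows (.reg digit)))
    (setReg rest (.sub (.reg rest) (.get pows (.reg digit))) ;;
      .assign assignment (.add (.reg digit) (.const 1)) (.const 1))
    (.assign assignment (.add (.reg digit) (.const 1)) (.const 0))

/-- Write the binary digits of `assignmentIdx` into the assignment. -/
def extractDigits : RAMProg :=
  setReg rest (.reg assignmentIdx) ;; forTo counter (.reg numEss)
    (setReg digit (.sub (.reg numEss) (.add (.reg counter) (.const 1))) ;; extractDigit)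

/-- Compute the sum in `𝔽₂` of the variables of the current equation. -/
def computeParity : RAMProg :=
  setReg parity (.const 0) ;;
    varLoop (setReg parity (.dist (.reg parity) (.get assignment (.get essLabels (.reg curVar)))))

/-- Add the weight of the current equation to that of the satisfied or the falsified ones. -/
def evalEquation : RAMProg :=
  computeParity ;; .cond (.dist (.reg parity) .curRhs)
    (setReg falseWeight (.add (.reg falseWeight) .curWeight))
    (setReg satWeight (.add (.reg satWeight) .curWeight))

/-- Compute the weights of the equations satisfied and falsified by the assignment. -/
def evalAssignment : RAMProg :=
  setReg satWeight (.const 0) ;; setReg falseWeight (.const 0) ;; eqLoop evalEquation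

/-- Record in `answer` whether the assignment with number `assignmentIdx` attains the parameter. -/
def testAssignment : RAMProg :=
  extractDigits ;; evalAssignment ;;
    .cond (.sub (.add (.reg satWeight) (.const 1)) (.add (.reg falseWeight) (.get 0 (.const 1))))
      (setReg answer (.const 1)) .skip

/-- Test all assignments of the essential variables. -/
def search : RAMProg :=
  setReg numAssignments (.get pows (.reg numEss)) ;;
    forTo assignmentIdx (.reg numAssignments) testAssignment

/-- The decision procedure for Max `r`-Lin AA. -/
def solver (r : ℕ) : RAMProg :=
  analysis ;; .cond (.triviallyYes r) (setReg answer (.const 1)) search ;;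
    .assign 1 (.const 0) (.const 1) ;; .assign 1 (.const 1) (.reg answer)

variable {B k : ℕ} {eqs : List FlatEq} {s : RAMState} {D : List ℕ} {e : FlatEq} {x : ℕ → ℤˣ}

theorem runs_extractDigit {a m : ℕ} (hm : s digit 0 = m) (hpow : s pows m = 2 ^ m)
    (hrest : s rest 0 = a % 2 ^ (m + 1)) : Runs B extractDigit s fun s' =>
      s' rest 0 = a % 2 ^ m ∧
        s' assignment = Function.update (s assignment) (m + 1) (a.testBit m).toNat := by
  rw [Nat.mod_pow_succ, ← Nat.toNat_testBit] at hrest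
  have : a % 2 ^ m < 2 ^ m := Nat.mod_lt _ (by positivity)
  have htest : (RAMExpr.sub (.add (.reg rest) (.const 1)) (.get pows (.reg digit))).eval s ≠ 0 ↔
      a.testBit m = true := by
    simp only [RAMExpr.eval, hm, hpow, hrest]
    cases a.testBit m <;> simp <;> omega
  refine .cond (fun h => .seq (.assign (.assign ?_))) fun h => .assign ?_
  · rw [htest] at h
    simp [RAMExpr.eval, hm, hpow, hrest, h]
  · rw [← not_ne_iff, htest, Bool.not_eq_true] at h
    simp [RAMExpr.eval, hm, hrest, h]

theorem runs_extractDigits {N a : ℕ} (hB : N ≤ B) (hN : s numEss 0 = N)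
    (hpow : ∀ i ≤ N, s pows i = 2 ^ i) (hzero : s assignment 0 = 0) (hidx : s assignmentIdx 0 = a)
    (ha : a < 2 ^ N) : Runs B extractDigits s fun s' =>
      s' assignment 0 = 0 ∧ ∀ d < N, s' assignment (d + 1) = (a.testBit d).toNat := by
  refine .seq (.assign ((Runs.forTo (n := N) (fun j s => s rest 0 = a % 2 ^ (N - j) ∧
    s assignment 0 = 0 ∧ ∀ d < N, N - j ≤ d → s assignment (d + 1) = (a.testBit d).toNat) hB rfl
    ?_ (fun j s v h => by simpa using h) ?_ ?_).mono ?_))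
  · intro s' hf
    simpa [RAMExpr.eval, hf numEss rfl] using hN
  · refine ⟨?_, by simpa using hzero, fun d hd hd' => absurd hd' (by omega)⟩
    simp [RAMExpr.eval, hidx, Nat.mod_eq_of_lt ha]
  · rintro j s₁ hj hf hcount ⟨hrest, hzero₁, hdone⟩
    obtain ⟨m, hm⟩ : ∃ m, N - j = m + 1 := ⟨N - j - 1, by omega⟩
    have hm' : N - (j + 1) = m := by omega
    have hN₁ : s₁ numEss 0 = N := by rw [hf numEss rfl]; simpa using hN
    have hpow₁ : s₁ pows = s pows := by simp [hf pows rfl]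
    rw [hm] at hrest
    refine .seq (.assign ((runs_extractDigit (a := a) (m := m) (by simp [RAMExpr.eval, *])
      (by simp [hpow₁, hpow m (by omega)]) (by simpa using hrest)).mono ?_))
    rintro s₂ - ⟨hrest₂, hassign⟩
    rw [RAMState.write_of_ne _ _ _ (by decide)] at hassign
    refine ⟨by rw [hrest₂, hm'], by simp [hassign, hzero₁], fun d hd hmd => ?_⟩
    rw [hassign]
    by_cases hdm : d = m
    · simp [hdm]
    · simpa [hdm] using hdone d hd (by omega)
  · rintro s' - ⟨-, hzero', hdigits⟩
    exact ⟨hzero', fun d hd => hdigits d hd (by omega)⟩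

theorem runs_computeParity (hB : e.vars.length ≤ B) (hs : Holds (s 0) (s eqPtr 0) e.enc)
    (hx : ∀ v, s assignment (s essLabels v) = signBit (x v)) :
    Runs B computeParity s fun s' => s' parity 0 = signBit (e.vars.map x).prod := by
  refine .seq (.assign (Runs.varLoop (fun vs s => s parity 0 = signBit (vs.map x).prod) hB
    (by simpa [RAMExpr.eval] using hs) rfl rfl rfl (fun l s v h => by simpa using h)
    (fun l s v h => by simpa using h) (by simp [RAMExpr.eval, signBit]) ?_))
  rintro vs v vs' s' - hf hv hI
  have hxv : s' assignment (s' essLabels v) = signBit (x v) := by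
    rw [hf assignment rfl, hf essLabels rfl]
    simpa using hx v
  refine .assign ?_
  simp only [RAMState.write_self, RAMExpr.dist, RAMExpr.eval, Function.update_self, hv, hxv, hI,
    List.map_append, List.map_singleton, List.prod_append, List.prod_singleton, signBit_mul]

theorem runs_evalEquation {l : List FlatEq} (hB : e.vars.length ≤ B)
    (hs : Holds (s 0) (s eqPtr 0) e.enc) (hb : e.b < 2)
    (hx : ∀ v, s assignment (s essLabels v) = signBit (x v))
    (h : (s satWeight 0 : ℤ) - s falseWeight 0 = signExcess l x) :
    Runs B evalEquation s fun s' =>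
      (s' satWeight 0 : ℤ) - s' falseWeight 0 = signExcess (l ++ [e]) x := by
  refine .seq ((runs_computeParity hB hs hx).mono fun s₁ hf hpar => ?_)
  have hs₁ : Holds (s₁ 0) (s₁ eqPtr 0) e.enc := by rwa [hf 0 rfl, hf eqPtr rfl]
  have hdist : (RAMExpr.dist (.reg parity) .curRhs).eval s₁ = 0 ↔
      signBit (e.vars.map x).prod = e.b := by
    simp only [RAMExpr.dist, RAMExpr.eval, RAMExpr.eval_curRhs hs₁, hpar]
    omega
  rw [← hf satWeight rfl, ← hf falseWeight rfl] at h
  rw [signExcess_concat, FlatEq.signedWeight_mul_sign hb, ← h]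
  refine .cond (fun h0 => .assign ?_) fun h0 => .assign ?_
  · rw [if_neg (hdist.not.1 h0)]
    simp [RAMExpr.eval, RAMExpr.eval_curWeight hs₁]
    ring
  · rw [if_pos (hdist.1 h0)]
    simp [RAMExpr.eval, RAMExpr.eval_curWeight hs₁]
    ring

theorem runs_evalAssignment (h : Loaded B k eqs (s 0)) (hb : ∀ e ∈ eqs, e.b < 2)
    (hx : ∀ v, s assignment (s essLabels v) = signBit (x v)) :
    Runs B evalAssignment s fun s' =>
      (s' satWeight 0 : ℤ) - s' falseWeight 0 = signExcess eqs x := by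
  refine .seq (.assign (.seq (.assign (Runs.eqLoop
    (fun l s => (s satWeight 0 : ℤ) - s falseWeight 0 = signExcess l x) h.length_le
    (by simpa using h.count) (by simpa using h.holds) rfl rfl rfl
    (fun l s v h => by simpa using h) (fun l s v h => by simpa using h)
    (by simp [RAMExpr.eval, signExcess]) ?_))))
  intro l e l' s₁ hel hf hs hI
  have he : e ∈ eqs := by simp [hel]
  refine runs_evalEquation (h.vars_length_le he) hs (hb e he) (fun v => ?_) hI
  rw [hf assignment rfl, hf essLabels rfl]
  simpa using hx v

open scoped Classical in
theorem runs_testAssignment {a : ℕ} (h : Loaded B k eqs (s 0)) (hb : ∀ e ∈ eqs, e.b < 2)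
    (hlab : s essLabels = label D) (hN : s numEss 0 = D.length)
    (hpow : ∀ i ≤ D.length, s pows i = 2 ^ i) (hzero : s assignment 0 = 0)
    (hidx : s assignmentIdx 0 = a) (ha : a < 2 ^ D.length) (hB : D.length ≤ B) :
    Runs B testAssignment s fun s' => s' assignment 0 = 0 ∧
      s' answer 0 = if (k : ℤ) ≤ signExcess eqs (digitSigns D a) then 1 else s answer 0 := by
  refine .seq ((runs_extractDigits hB hN hpow hzero hidx ha).mono ?_)
  rintro s₁ hf₁ ⟨hzero₁, hdigits⟩
  have hx (v : ℕ) : s₁ assignment (s₁ essLabels v) = signBit (digitSigns D a v) := by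
    rw [hf₁ essLabels rfl, hlab, digitSigns]
    rcases hv : label D v with _ | d
    · simp [hzero₁, signBit]
    · have hle := label_le D v
      rw [hdigits d (by omega)]
      cases hbit : a.testBit d <;> simp [hbit, signBit]
  have h₁ : Loaded B k eqs (s₁ 0) := by rwa [hf₁ 0 rfl]
  refine .seq ((runs_evalAssignment h₁ hb hx).mono fun s₂ hf₂ hexc => ?_)
  have hk : s₂ 0 1 = k := by rw [hf₂ 0 rfl, h₁.param]
  have hzero₂ : s₂ assignment 0 = 0 := by rwa [hf₂ assignment rfl]
  rw [← hexc, ← hf₁ answer rfl, ← hf₂ answer rfl]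
  refine .cond (fun h0 => .assign ⟨by simpa using hzero₂, ?_⟩) fun h0 => .skip ⟨hzero₂, ?_⟩
  all_goals simp only [RAMExpr.eval, hk] at h0
  · rw [if_pos (by omega)]
    simp [RAMExpr.eval]
  · rw [if_neg (by omega)]

open scoped Classical in
theorem runs_search (h : Loaded B k eqs (s 0)) (hl : ∀ e ∈ eqs, e.vars.Nodup)
    (hb : ∀ e ∈ eqs, e.b < 2) (ha : Analyzed k eqs s)
    (hB : 2 ^ (essentialVars eqs eqs).length ≤ B) (hassign : s assignment = 0)
    (hans : s answer = 0) :
    Runs B search s fun s' => s' answer 0 = if AttainsExcess eqs k then 1 else 0 := by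
  have hpow : ∀ i ≤ (essentialVars eqs eqs).length, s pows i = 2 ^ i :=
    fun i hi => ha.pows i (hi.trans (length_essentialVars_le eqs))
  have hlab := ha.essLabels
  have hN := ha.numEss
  simp only [attainsExcess_iff_exists_digitSigns hl]
  generalize essentialVars eqs eqs = D at *
  refine .seq (.assign ((Runs.forTo (n := 2 ^ D.length) (fun j s => s assignment 0 = 0 ∧
    s answer 0 = if ∃ a < j, (k : ℤ) ≤ signExcess eqs (digitSigns D a) then 1 else 0) hB rfl ?_
    (fun j s v h => by simpa using h) (by simp [hassign, hans]) ?_).mono fun s' _ hI => hI.2))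
  · intro s' hf
    simp [RAMExpr.eval, hf numAssignments rfl, hN, hpow]
  · rintro j s₁ hj hf hidx ⟨hzero, hanswer⟩
    have hsame (b : ℕ) (hne : b ≠ numAssignments)
        (hw : (forTo assignmentIdx (.reg numAssignments) testAssignment).writes b = false) :
        s₁ b = s b := by rw [hf b hw, RAMState.write_of_ne _ _ _ hne]
    refine (runs_testAssignment (by rwa [hsame 0 (by decide) rfl]) hb
      ((hsame _ (by decide) rfl).trans hlab)
      ((congrFun (hsame _ (by decide) rfl) 0).trans hN)
      (hsame pows (by decide) rfl ▸ hpow) hzero hidx hj (Nat.lt_two_pow_self.le.trans hB)).mono ?_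
    rintro s₂ - ⟨hzero₂, hanswer₂⟩
    refine ⟨hzero₂, ?_⟩
    have hsucc : (∃ a < j + 1, (k : ℤ) ≤ signExcess eqs (digitSigns D a)) ↔
        (k : ℤ) ≤ signExcess eqs (digitSigns D j) ∨
          ∃ a < j, (k : ℤ) ≤ signExcess eqs (digitSigns D a) := by
      simp only [Nat.lt_succ_iff_lt_or_eq, or_and_right, exists_or, exists_eq_left, or_comm]
    rw [hanswer₂, hanswer, if_congr hsucc rfl rfl, ite_or]

open scoped Classical in
theorem runs_solver {r n : ℕ} (h : Loaded B k eqs (s 0)) (hl : ∀ e ∈ eqs, e.Valid r n) (hr : 0 < r)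
    (hzero : ∀ b ≠ 0, s b = 0) (hB : 2 ^ (2 * r * k) ≤ B) :
    Runs B (solver r) s fun s' => s'.HasOutput [if AttainsExcess eqs k then 1 else 0] := by
  have hnodup : ∀ e ∈ eqs, e.vars.Nodup := fun e he => (hl e he).nodup
  refine .seq ((runs_analysis h hnodup hzero).mono fun s₁ hf₁ ha => ?_)
  have h₁ : Loaded B k eqs (s₁ 0) := by rwa [hf₁ 0 rfl]
  have hdecide : Runs B (.cond (.triviallyYes r) (setReg answer (.const 1)) search) s₁ fun s' =>
      s' answer 0 = if AttainsExcess eqs k then 1 else 0 := by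
    refine .cond (fun hyes => .assign ?_) fun hno => ?_
    · rw [if_pos (ha.attainsExcess_of_eval_triviallyYes_ne_zero h₁.param hl hr hyes)]
      simp [RAMExpr.eval]
    · rw [ha.eval_triviallyYes_eq_zero_iff h₁.param] at hno
      exact runs_search h₁ hnodup (fun e he => (hl e he).b_lt) ha
        ((Nat.pow_le_pow_right two_pos hno.2.le).trans hB)
        (by rw [hf₁ _ rfl, hzero _ (by decide)]) (by rw [hf₁ _ rfl, hzero _ (by decide)])
  refine .seq (hdecide.mono fun s₂ _ hans => .seq (.assign (.assign ?_)))
  rw [RAMState.hasOutput_iff, holds_cons]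
  exact ⟨by simp [RAMExpr.eval], by simp [RAMExpr.eval, hans], holds_nil⟩

end RAMProg

/-! ### Output of the reduced system -/

namespace Bank

/-- Marks the labels of the variables of the current equation. -/
abbrev marks : ℕ := 25
/-- Marks the keys of the equations already merged. -/
abbrev done : ℕ := 26
/-- Address of the first free cell of the output. -/
abbrev outPtr : ℕ := 27
abbrev numOut : ℕ := 28

end Bank

theorem FlatEq.length_vars_reduce (eqs : List FlatEq) {e : FlatEq} {D : List ℕ}
    (he : e.vars.Nodup) (hD : ∀ v ∈ e.vars, v ∈ D) :
    (e.reduce eqs D).vars.length = e.vars.length := by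
  rw [← List.toFinset_card_of_nodup (nodup_vars_reduce eqs D e), ← varSet, varSet_reduce hD,
    Finset.card_image_of_injOn, varSet, List.toFinset_card_of_nodup he]
  exact fun v hv _ _ h => (List.idxOf_inj (hD v (mem_varSet.1 hv))).1 h

/-- The output cells from address `4` on hold the list `L`. -/
def Written (L : List ℕ) (s : RAMState) : Prop := Holds (s 1) 4 L ∧ s outPtr 0 = 4 + L.length

theorem Written.congr {L : List ℕ} {s s' : RAMState} (h : Written L s) (hout : s' 1 = s 1)
    (hptr : s' outPtr = s outPtr) : Written L s' := by
  rwa [Written, hout, hptr]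

/-- The state after the equations in `l` were merged and output. -/
structure Emitted (eqs l : List FlatEq) (s : RAMState) : Prop where
  marks : s marks = 0
  done : ∀ e ∈ eqs, s done (e.key (allVars eqs)) ≠ 0 ↔
    e.varSet ∈ (representatives eqs l).map FlatEq.varSet
  numOut : s numOut 0 = (representatives eqs l).length
  written : Written (((representatives eqs l).map
    (FlatEq.reduce eqs (essentialVars eqs eqs))).flatMap FlatEq.enc) s

theorem Emitted.frame {eqs l : List FlatEq} {s s' : RAMState} {P : RAMProg} (h : Emitted eqs l s)
    (hf : P.Frame s s') (hw : ∀ b ∈ [Bank.marks, Bank.done, Bank.numOut, 1, outPtr],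
      P.writes b = false) : Emitted eqs l s' := by
  simp only [List.forall_mem_cons] at hw
  obtain ⟨h₁, h₂, h₃, h₄, h₅, -⟩ := hw
  exact ⟨hf _ h₁ ▸ h.marks, hf _ h₂ ▸ h.done, hf _ h₃ ▸ h.numOut,
    h.written.congr (hf _ h₄) (hf _ h₅)⟩

theorem representatives_concat_eq_self {eqs l : List FlatEq} {e : FlatEq}
    (h : netWeight eqs e ≠ 0 → e.varSet ∈ (representatives eqs l).map FlatEq.varSet) :
    representatives eqs (l ++ [e]) = representatives eqs l := by
  by_cases h0 : netWeight eqs e = 0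
  · simp [representatives, essentialEqs, h0]
  · have happend : essentialEqs eqs (l ++ [e]) = essentialEqs eqs l ++ [e] := by
      simp [essentialEqs, h0]
    rw [representatives, happend, firstOccs_concat_of_mem (mem_map_firstOccs.1 (h h0)),
      representatives]

theorem representatives_concat {eqs l : List FlatEq} {e : FlatEq} (h0 : netWeight eqs e ≠ 0)
    (h : e.varSet ∉ (representatives eqs l).map FlatEq.varSet) :
    representatives eqs (l ++ [e]) = representatives eqs l ++ [e] := by
  have happend : essentialEqs eqs (l ++ [e]) = essentialEqs eqs l ++ [e] := by
    simp [essentialEqs, h0]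
  rw [representatives, happend, firstOccs_concat_of_notMem (mt mem_map_firstOccs.2 h),
    representatives]

namespace RAMProg

/-- Append the value of the expression to the output. -/
def emit (e : RAMExpr) : RAMProg :=
  .assign 1 (.reg outPtr) e ;; setReg outPtr (.add (.reg outPtr) (.const 1))

/-- Set the marks at the labels of the variables of the current equation to `c`. -/
def setMarks (c : ℕ) : RAMProg := varLoop (.assign marks (.get essLabels (.reg curVar)) (.const c))

/-- Output the positions that are marked, in increasing order. -/
def emitMarked : RAMProg :=
  forTo counter (.reg numEss)
    (.cond (.get marks (.add (.reg counter) (.const 1))) (emit (.reg counter)) .skip)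

/-- Output the renamed variables of the current equation in increasing order. -/
def emitVars : RAMProg := setMarks 1 ;; emitMarked ;; setMarks 0

/-- Output the merger of the equations that have the same variables as the current one. -/
def emitEq : RAMProg :=
  emit (.get 0 (.reg eqPtr)) ;; emitVars ;;
    emit (.sub (.const 1) (.sub (.const 1)
      (.sub (.get negWeight (.reg key)) (.get posWeight (.reg key))))) ;;
    emit .absNetWeight

/-- Output the current equation merged with those with the same variables, unless it cancels or was
merged before. -/
def emitNew : RAMProg :=
  .cond .absNetWeight
    (.cond (.get done (.reg key)) .skip
      (.assign done (.reg key) (.const 1) ;; setReg numOut (.add (.reg numOut) (.const 1)) ;;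
        emitEq)) .skip

/-- Output all equations of the reduced system. -/
def emitPass : RAMProg := setReg outPtr (.const 4) ;; eqLoop (computeKey ;; emitNew)

/-- Write the length of the output and the three leading numbers of the encoding. -/
def emitHeader : RAMProg :=
  .assign 1 (.const 0) (.sub (.reg outPtr) (.const 1)) ;;
    .assign 1 (.const 1) (.get 0 (.const 1)) ;; .assign 1 (.const 2) (.reg numEss) ;;
    .assign 1 (.const 3) (.reg numOut)

/-- The kernelization of Max `r`-Lin AA. -/
def kernelizer (r : ℕ) : RAMProg :=
  analysis ;; .cond (.triviallyYes r) (.assign 1 (.const 0) (.const 3)) (emitPass ;; emitHeader)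

variable {B k : ℕ} {eqs : List FlatEq} {s : RAMState} {D L : List ℕ} {e : FlatEq}

theorem runs_emit {a : ℕ} {e : RAMExpr} (h : Written L s) (he : e.eval s = a) :
    Runs B (emit e) s (Written (L ++ [a])) := by
  refine .seq (.assign (.assign ⟨?_, ?_⟩))
  · simpa [RAMExpr.eval, he] using h.1.concat h.2 a
  · simp [RAMExpr.eval, h.2, add_assoc]

theorem runs_setMarks {c : ℕ} (hB : e.vars.length ≤ B) (hs : Holds (s 0) (s eqPtr 0) e.enc)
    (hlab : s essLabels = label D) : Runs B (setMarks c) s fun s' =>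
      s' marks = fun a => if a ∈ e.vars.map (label D) then c else s marks a := by
  refine Runs.varLoop
    (fun vs s' => s' marks = fun a => if a ∈ vs.map (label D) then c else s marks a) hB hs
    rfl rfl rfl (fun l s v h => by simpa using h) (fun l s v h => by simpa using h) (by simp) ?_
  rintro vs v vs' s' - hf hv hI
  refine .assign (funext fun a => ?_)
  rw [← hf essLabels rfl] at hlab
  by_cases ha : a = label D v
  · simp [RAMExpr.eval, hv, hlab, ha]
  · simp [RAMExpr.eval, hv, hlab, ha, hI]

theorem runs_emitMarked {S : List ℕ} (hDB : D.length ≤ B) (hN : s numEss 0 = D.length)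
    (hmarks : ∀ i < D.length, s marks (i + 1) ≠ 0 ↔ i ∈ S) (hL : Written L s) :
    Runs B emitMarked s (Written (L ++ (List.range D.length).filter (· ∈ S))) := by
  refine Runs.forTo (fun j => Written (L ++ (List.range j).filter (· ∈ S))) hDB rfl ?_
    (fun j s v h => h.congr (by simp) (by simp)) (by simpa using hL) ?_
  · intro s' hf
    simpa [RAMExpr.eval, hf numEss rfl] using hN
  · intro j s' hj hf hcount hI
    have hmark : (RAMExpr.get marks (.add (.reg counter) (.const 1))).eval s' ≠ 0 ↔ j ∈ S := by
      rw [← hmarks j hj, ← hf marks rfl, ← hcount]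
      rfl
    rw [List.range_succ, List.filter_append, ← List.append_assoc]
    refine .cond (fun h1 => ?_) fun h0 => .skip ?_
    · rw [List.filter_cons_of_pos (by simpa using hmark.1 h1)]
      exact runs_emit hI hcount
    · rw [List.filter_cons_of_neg (by simpa using mt hmark.2 (not_not.2 h0))]
      simpa using hI

theorem runs_emitVars (hB : e.vars.length ≤ B) (hDB : D.length ≤ B)
    (hs : Holds (s 0) (s eqPtr 0) e.enc) (hlab : s essLabels = label D)
    (hN : s numEss 0 = D.length) (hD : ∀ v ∈ e.vars, v ∈ D) (hmarks : s marks = 0)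
    (hL : Written L s) : Runs B emitVars s fun s' =>
      s' marks = 0 ∧ Written (L ++ (e.reduce eqs D).vars) s' := by
  refine .seq ((runs_setMarks hB hs hlab).mono fun s₁ hf₁ hmarks₁ => ?_)
  have hiff (i : ℕ) : s₁ marks (i + 1) ≠ 0 ↔ i ∈ e.vars.map D.idxOf := by
    simp only [hmarks₁, hmarks, Pi.zero_apply, ne_eq, ite_eq_right_iff, one_ne_zero, imp_false,
      not_not, List.mem_map]
    refine exists_congr fun v => and_congr_right fun hv => ?_
    simp [label, hD v hv]
  refine .seq ((runs_emitMarked hDB ((congrFun (hf₁ numEss rfl) 0).trans hN) (fun i _ => hiff i)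
    (hL.congr (hf₁ _ rfl) (hf₁ _ rfl))).mono fun s₂ hf₂ hL₂ => ?_)
  refine (runs_setMarks hB (by rwa [hf₂ 0 rfl, hf₂ eqPtr rfl, hf₁ 0 rfl, hf₁ eqPtr rfl])
    (by rwa [hf₂ essLabels rfl, hf₁ essLabels rfl])).mono fun s₃ hf₃ hmarks₃ => ?_
  refine ⟨?_, hL₂.congr (hf₃ _ rfl) (hf₃ _ rfl)⟩
  ext a
  simp only [hmarks₃, hf₂ marks rfl, hmarks₁, hmarks, Pi.zero_apply]
  split_ifs <;> rfl

theorem runs_emitEq (hl : ∀ e ∈ eqs, e.vars.Nodup) (he : e ∈ eqs) (hs : AtEquation eqs e s)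
    (hB : e.vars.length ≤ B) (hDB : D.length ≤ B) (hlab : s essLabels = label D)
    (hN : s numEss 0 = D.length) (hD : ∀ v ∈ e.vars, v ∈ D) (hmarks : s marks = 0)
    (hL : Written L s) : Runs B emitEq s fun s' =>
      s' marks = 0 ∧ Written (L ++ (e.reduce eqs D).enc) s' := by
  have hlen : (RAMExpr.get 0 (.reg eqPtr)).eval s = (e.reduce eqs D).vars.length := by
    rw [FlatEq.length_vars_reduce eqs (hl e he) hD]
    exact (FlatEq.holds_enc.1 hs.holds).1
  refine .seq ((runs_emit hL hlen).mono fun s₁ hf₁ hL₁ => ?_)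
  have hs₁ := hs.frame hf₁ (by decide)
  refine .seq ((runs_emitVars (eqs := eqs) hB hDB hs₁.holds ((hf₁ _ rfl).trans hlab)
    ((congrFun (hf₁ _ rfl) 0).trans hN) hD ((hf₁ _ rfl).trans hmarks) hL₁).mono ?_)
  rintro s₂ hf₂ ⟨hmarks₂, hL₂⟩
  have hs₂ := hs₁.frame hf₂ (by decide)
  have hb : (RAMExpr.sub (.const 1) (.sub (.const 1)
      (.sub (.get negWeight (.reg key)) (.get posWeight (.reg key))))).eval s₂ =
        (e.reduce eqs D).b := by
    have := hs₂.weight_sub_weight hl he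
    simp only [RAMExpr.eval, FlatEq.reduce]
    split_ifs <;> omega
  refine .seq ((runs_emit hL₂ hb).mono fun s₃ hf₃ hL₃ => ?_)
  refine (runs_emit hL₃ ((hs₂.frame hf₃ (by decide)).eval_absNetWeight hl he)).mono
    fun s₄ hf₄ hL₄ => ⟨?_, by simpa [FlatEq.enc, FlatEq.reduce] using hL₄⟩
  rw [hf₄ marks rfl, hf₃ marks rfl, hmarks₂]

theorem runs_emitNew {l : List FlatEq} (hl : ∀ e ∈ eqs, e.vars.Nodup) (he : e ∈ eqs)
    (hs : AtEquation eqs e s) (hB : e.vars.length ≤ B) (hDB : (essentialVars eqs eqs).length ≤ B)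
    (hlab : s essLabels = label (essentialVars eqs eqs))
    (hN : s numEss 0 = (essentialVars eqs eqs).length) (h : Emitted eqs l s) :
    Runs B emitNew s (Emitted eqs (l ++ [e])) := by
  have hdone : (RAMExpr.get done (.reg key)).eval s ≠ 0 ↔
      e.varSet ∈ (representatives eqs l).map FlatEq.varSet := by
    rw [← h.done e he, ← hs.key]
    rfl
  have hself (hmem : netWeight eqs e ≠ 0 → e.varSet ∈ (representatives eqs l).map FlatEq.varSet) :
      Emitted eqs (l ++ [e]) s := by
    have hrep := representatives_concat_eq_self hmem
    exact ⟨h.marks, hrep ▸ h.done, hrep ▸ h.numOut, hrep ▸ h.written⟩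
  refine .cond (fun hw => .cond (fun hold => .skip (hself fun _ => hdone.1 hold)) fun hnew => ?_)
    fun hw => .skip (hself fun hne => absurd hw ?_)
  · rw [hs.eval_absNetWeight hl he, Int.natAbs_ne_zero] at hw
    have hrep := representatives_concat hw (mt hdone.2 (not_not.2 hnew))
    refine .seq (.assign (.seq (.assign (Runs.mono (runs_emitEq hl he
      ⟨⟨hs.labels, hs.pows, hs.pos, hs.neg⟩, hs.holds, hs.key⟩ hB hDB hlab hN
      (fun v hv => mem_essentialVars.2 ⟨e, he, hw, hv⟩) h.marks h.written) ?_))))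
    rintro s' hf ⟨hmarks, hwritten⟩
    refine ⟨hmarks, fun e' he' => ?_, ?_, ?_⟩
    · rw [hf done rfl, hrep, List.map_append, List.mem_append, ← h.done e' he', List.map_singleton,
        List.mem_singleton, ← FlatEq.key_allVars_eq_iff hl he' he]
      by_cases heq : e'.key (allVars eqs) = e.key (allVars eqs) <;>
        simp [RAMExpr.eval, hs.key, heq]
    · rw [hf numOut rfl, hrep]
      simp [RAMExpr.eval, h.numOut]
    · rw [hrep]
      simpa using hwritten
  · rwa [hs.eval_absNetWeight hl he, ← Ne, Int.natAbs_ne_zero]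

theorem runs_emitPass (h : Loaded B k eqs (s 0)) (hl : ∀ e ∈ eqs, e.vars.Nodup)
    (ha : Analyzed k eqs s) (hmarks : s marks = 0) (hdone : s done = 0) (hout : s numOut = 0) :
    Runs B emitPass s (Emitted eqs eqs) := by
  have hDB := (length_essentialVars_le eqs).trans ((length_allVars_le eqs).trans h.occs_le)
  refine .seq (.assign (Runs.eqLoop (Emitted eqs) h.length_le h.count h.holds rfl rfl rfl
    (fun l s v h => ⟨h.marks, h.done, h.numOut, h.written⟩)
    (fun l s v h => ⟨h.marks, h.done, h.numOut, h.written⟩)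
    ⟨hmarks, by simp [hdone, representatives, essentialEqs, firstOccs_nil],
      by simp [hout, representatives, essentialEqs, firstOccs_nil], ?_⟩ ?_))
  · simp [Written, holds_nil, representatives, essentialEqs, firstOccs_nil, RAMExpr.eval]
  · intro l e l' s₁ hel hf₁ hs hI
    have he : e ∈ eqs := by simp [hel]
    have ht : Tables eqs s₁ := ⟨hf₁ labels rfl ▸ ha.labels, hf₁ pows rfl ▸ ha.pows,
      hf₁ posWeight rfl ▸ ha.pos, hf₁ negWeight rfl ▸ ha.neg⟩
    refine .seq ((runs_computeKey_atEquation (h.vars_length_le he) ht hs).mono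
      fun s₂ hf₂ hs₂ => ?_)
    exact runs_emitNew hl he hs₂ (h.vars_length_le he) hDB
      ((hf₂ _ rfl).trans ((hf₁ _ rfl).trans ha.essLabels))
      ((congrFun ((hf₂ numEss rfl).trans (hf₁ _ rfl)) 0).trans ha.numEss) (hI.frame hf₂ (by decide))

theorem runs_emitHeader {m n : ℕ} (hL : Written L s) (hk : s 0 1 = k) (hn : s numEss 0 = n)
    (hm : s numOut 0 = m) : Runs B emitHeader s fun s' => s'.HasOutput (k :: n :: m :: L) := by
  refine .seq (.assign (.seq (.assign (.seq (.assign (.assign ?_))))))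
  rw [RAMState.hasOutput_iff]
  simp only [holds_cons]
  refine ⟨?_, ?_, ?_, ?_, ?_⟩
  · simp [RAMExpr.eval, hL.2]
    omega
  · simp [RAMExpr.eval, hk]
  · simp [RAMExpr.eval, hn]
  · simp [RAMExpr.eval, hm]
  · simp only [RAMState.write_self, RAMExpr.eval]
    exact (((hL.1.update_of_lt (by simp) _).update_of_lt (by simp) _).update_of_lt (by simp)
      _).update_of_lt (by simp) _

theorem runs_kernelizer {r n : ℕ} (h : Loaded B k eqs (s 0)) (hl : ∀ e ∈ eqs, e.Valid r n)
    (hr : 0 < r) (hzero : ∀ b ≠ 0, s b = 0) : Runs B (kernelizer r) s fun s' =>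
      (AttainsExcess eqs k ∧ s'.HasOutput [0, 0, 0]) ∨
      (essentialVars eqs eqs).length < 2 * r * k ∧ (∀ e ∈ eqs, (netWeight eqs e).natAbs < k) ∧
        s'.HasOutput (k :: (essentialVars eqs eqs).length :: (reducedSystem eqs).length ::
          (reducedSystem eqs).flatMap FlatEq.enc) := by
  have hnodup : ∀ e ∈ eqs, e.vars.Nodup := fun e he => (hl e he).nodup
  refine .seq ((runs_analysis h hnodup hzero).mono fun s₁ hf₁ ha => ?_)
  have h₁ : Loaded B k eqs (s₁ 0) := by rwa [hf₁ 0 rfl]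
  have hzero₁ (b : ℕ) (hb : b ≠ 0) (hw : analysis.writes b = false) : s₁ b = 0 := by
    rw [hf₁ b hw, hzero b hb]
  refine .cond (fun hyes => .assign (.inl
    ⟨ha.attainsExcess_of_eval_triviallyYes_ne_zero h₁.param hl hr hyes, ?_⟩)) fun hno => ?_
  · rw [RAMState.hasOutput_iff]
    simp [holds_cons, holds_nil, RAMExpr.eval, hzero₁ 1 (by decide) rfl]
  · rw [ha.eval_triviallyYes_eq_zero_iff h₁.param] at hno
    refine .seq ((runs_emitPass h₁ hnodup ha (hzero₁ _ (by decide) rfl) (hzero₁ _ (by decide) rfl)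
      (hzero₁ _ (by decide) rfl)).mono fun s₂ hf₂ hemit => ?_)
    refine (runs_emitHeader hemit.written ((congrFun (hf₂ 0 rfl) 1).trans h₁.param)
      ((congrFun (hf₂ _ rfl) 0).trans ha.numEss) hemit.numOut).mono fun s₃ _ hout =>
        .inr ⟨hno.2, hno.1, ?_⟩
    simpa [reducedSystem] using hout

end RAMProg

/-! ### Running times and the main theorem -/

theorem RAMState.init_of_ne_zero (l : List ℕ) : ∀ b ≠ 0, RAMState.init l b = 0 := by
  intro b hb
  ext a
  simp [RAMState.init, hb]

theorem length_le_length_flatMap_enc (l : List FlatEq) :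
    l.length ≤ (l.flatMap FlatEq.enc).length := by
  rw [List.length_flatMap, ← List.length_map (f := fun e : FlatEq => e.enc.length)]
  exact List.length_le_sum_of_one_le _ (by simp [FlatEq.enc])

theorem length_flatMap_vars_le_length_flatMap_enc (l : List FlatEq) :
    (l.flatMap FlatEq.vars).length ≤ (l.flatMap FlatEq.enc).length := by
  rw [List.length_flatMap, List.length_flatMap]
  refine List.sum_le_sum fun e _ => ?_
  simp only [FlatEq.enc, List.length_append, List.length_cons]
  omega

theorem length_flatMap_enc_le {r : ℕ} {l : List FlatEq} (h : ∀ e ∈ l, e.vars.length ≤ r) :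
    (l.flatMap FlatEq.enc).length ≤ l.length * (r + 3) := by
  rw [List.length_flatMap, ← List.length_map (f := fun e : FlatEq => e.enc.length), ← smul_eq_mul]
  refine List.sum_le_card_nsmul _ _ (List.forall_mem_map.2 fun e he => ?_)
  simpa [FlatEq.enc, add_assoc, add_comm 1] using h e he

theorem length_le_bitLength (l : List ℕ) : l.length ≤ bitLength l := by
  rw [bitLength, ← List.length_map (f := fun a => Nat.size a + 1)]
  exact List.length_le_sum_of_one_le _ (by simp)

theorem bitLength_le {l : List ℕ} {M : ℕ} (h : ∀ a ∈ l, a ≤ M) :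
    bitLength l ≤ l.length * (M + 1) := by
  rw [bitLength, ← List.length_map (f := fun a => Nat.size a + 1), ← smul_eq_mul]
  refine List.sum_le_card_nsmul _ _ (List.forall_mem_map.2 fun a ha => ?_)
  gcongr
  exact (Nat.size_le.2 a.lt_two_pow_self).trans (h a ha)

theorem FlatEq.Valid.le_of_mem_enc {r n k a : ℕ} {e : FlatEq} (he : e.Valid r n) (hw : e.w ≤ k)
    (ha : a ∈ e.enc) : a ≤ n + r + k + 1 := by
  have := he.length_le
  have := he.b_lt
  simp only [FlatEq.enc, List.mem_append, List.mem_cons, List.not_mem_nil, or_false] at ha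
  rcases ha with (rfl | ha) | rfl | rfl
  · omega
  · have := he.lt a ha
    omega
  · omega
  · omega

/-- An upper bound for the bit length of an encoded system with at most `n` variables and `m`
equations of weight at most `k`. -/
def encodingBound (r n m k : ℕ) : ℕ := (m * (r + 3) + 2) * (n + m + r + k + 2)

namespace RLinSystem

variable {r : ℕ} (I : RLinSystem r)

theorem loaded_init {B k : ℕ} (hB : (I.flat.flatMap FlatEq.enc).length ≤ B) :
    Loaded B k I.flat (RAMState.init (k :: I.encode) 0) := by
  have h := RAMState.holds_init (k :: I.encode)
  simp only [I.encode_eq, holds_cons] at h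
  rw [I.encode_eq]
  exact ⟨h.2.1, h.2.2.2.1, h.2.2.2.2, (length_le_length_flatMap_enc _).trans hB,
    (length_flatMap_vars_le_length_flatMap_enc _).trans hB⟩

theorem length_flatMap_enc_le_bitLength (k : ℕ) :
    (I.flat.flatMap FlatEq.enc).length ≤ bitLength (k :: I.encode) := by
  refine le_trans ?_ (length_le_bitLength _)
  simp only [I.encode_eq, List.length_cons]
  omega

theorem bitLength_encode_le {n m k : ℕ} (hn : I.n ≤ n) (hm : I.flat.length ≤ m)
    (hw : ∀ e ∈ I.flat, e.w ≤ k) : bitLength I.encode ≤ encodingBound r n m k := by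
  rw [I.encode_eq]
  refine (bitLength_le (M := n + m + r + k + 1) ?_).trans ?_
  · simp only [List.mem_cons, List.mem_flatMap]
    rintro a (rfl | rfl | ⟨e, he, ha⟩)
    · omega
    · omega
    · have := (I.valid_flat e he).le_of_mem_enc (hw e he) ha
      omega
  · have hlen := length_flatMap_enc_le fun e he => (I.valid_flat e he).length_le
    rw [encodingBound]
    gcongr
    simpa using hlen.trans (Nat.mul_le_mul_right _ hm)

end RLinSystem

theorem w_lt_of_mem_reducedSystem {eqs : List FlatEq} {k : ℕ}
    (h : ∀ e ∈ eqs, (netWeight eqs e).natAbs < k) : ∀ e ∈ reducedSystem eqs, e.w < k :=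
  List.forall_mem_map.2 fun e he =>
    h e (mem_essentialEqs.1 (mem_essentialEqs_of_mem_representatives he)).1

theorem hasKernelWith_two_mul_mul {r : ℕ} (hr : 0 < r) :
    (maxRLinAA r).HasKernelWith (fun I : RLinSystem r => I.n) fun k => 2 * r * k := by
  refine ⟨RAMProg.kernelizer r, (RAMProg.kernelizer r).timeBound, id,
    fun k => encodingBound r (2 * r * k) (2 ^ (2 * r * k)) k, fun (I : RLinSystem r) k => ?_⟩
  obtain ⟨t, s, htime, hexec, ⟨hyes, hout⟩ | ⟨hess, hweight, hout⟩⟩ := RAMProg.runs_kernelizer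
    (I.loaded_init (I.length_flatMap_enc_le_bitLength k)) I.valid_flat hr
    (RAMState.init_of_ne_zero _)
  · let E : RLinSystem r := ⟨0, []⟩
    refine ⟨E, 0, ⟨t, s, htime, hexec, hout⟩, ?_, Nat.zero_le _, ?_, Nat.zero_le _⟩
    · rw [maxRLinAA_yes_iff, maxRLinAA_yes_iff]
      exact iff_of_true hyes ⟨1, by simp [E, RLinSystem.flat, signExcess]⟩
    · exact E.bitLength_encode_le (Nat.zero_le _) (Nat.zero_le _) (by simp [E, RLinSystem.flat])
  · obtain ⟨K, hn, hflat⟩ := RLinSystem.exists_flat_eq (valid_reducedSystem I.valid_flat)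
    have hencode : K.encode = (essentialVars I.flat I.flat).length ::
        (reducedSystem I.flat).length :: (reducedSystem I.flat).flatMap FlatEq.enc := by
      rw [K.encode_eq, hn, hflat]
    have hKn : K.n ≤ 2 * r * k := hn.trans_le hess.le
    refine ⟨K, k, ⟨t, s, htime, hexec, ?_⟩, ?_, le_rfl, K.bitLength_encode_le hKn ?_ ?_, hKn⟩
    · change s.HasOutput (k :: K.encode)
      rwa [hencode]
    · rw [maxRLinAA_yes_iff, maxRLinAA_yes_iff, hflat,
        attainsExcess_reducedSystem_iff fun e he => (I.valid_flat e he).nodup]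
    · rw [hflat]
      exact (length_reducedSystem_le _).trans (Nat.pow_le_pow_right two_pos hess.le)
    · rw [hflat]
      exact fun e he => (w_lt_of_mem_reducedSystem hweight e he).le

theorem eval_le_eval_one_mul_succ_pow (p : Polynomial ℕ) (x : ℕ) :
    p.eval x ≤ p.eval 1 * (x + 1) ^ p.natDegree := by
  simp only [Polynomial.eval_eq_sum_range, one_pow, mul_one, Finset.sum_mul]
  refine Finset.sum_le_sum fun i hi => Nat.mul_le_mul_left _ ?_
  calc x ^ i ≤ (x + 1) ^ i := Nat.pow_le_pow_left x.le_succ i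
    _ ≤ (x + 1) ^ p.natDegree :=
      Nat.pow_le_pow_right x.succ_pos (Nat.lt_succ_iff.1 (Finset.mem_range.1 hi))

theorem mul_pow_le_pow_mul_pow {b C c d x y : ℕ} (hb : 2 ≤ b) (hx : x ≤ c * y) :
    C * x ^ d ≤ b ^ (C + d * c) * y ^ d := by
  have hle (z : ℕ) : z ≤ b ^ z := (Nat.lt_pow_self hb).le
  calc C * x ^ d ≤ b ^ C * (b ^ c * y) ^ d := by
        gcongr
        · exact hle C
        · exact hx.trans (Nat.mul_le_mul_right y (hle c))
    _ = b ^ (C + d * c) * y ^ d := by ring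

theorem mul_pow_le_two_pow_add_pow (C c d t m : ℕ) :
    C * (m * c + 2 ^ t + 1) ^ d ≤ 2 ^ (d * t + (C + d * (c + 2))) + m ^ (C + d * (c + 2) + d) := by
  have ht : 1 ≤ 2 ^ t := Nat.one_le_two_pow
  rcases le_or_gt m (2 ^ t) with hm | hm
  · have hx : m * c + 2 ^ t + 1 ≤ (c + 2) * 2 ^ t := by nlinarith
    refine ((mul_pow_le_pow_mul_pow le_rfl hx).trans_eq ?_).trans (Nat.le_add_right _ _)
    rw [← pow_mul, ← pow_add, mul_comm t, add_comm]
  · have hm2 : 2 ≤ m := by omega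
    have hx : m * c + 2 ^ t + 1 ≤ (c + 2) * m := by nlinarith
    refine ((mul_pow_le_pow_mul_pow hm2 hx).trans_eq ?_).trans (Nat.le_add_left _ _)
    rw [← pow_add]

theorem solvableInTime_two_pow_add_pow {r : ℕ} (hr : 0 < r) : ∃ a b d : ℕ,
    (maxRLinAA r).SolvableInTime fun (I : RLinSystem r) k => 2 ^ (a * k + b) + I.m ^ d := by
  classical
  set p := (RAMProg.solver r).timeBound
  refine ⟨p.natDegree * (2 * r), p.eval 1 + p.natDegree * (r + 3 + 2),
    p.eval 1 + p.natDegree * (r + 3 + 2) + p.natDegree, RAMProg.solver r,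
    fun (I : RLinSystem r) k => ?_⟩
  have hlen := length_flatMap_enc_le fun e he => (I.valid_flat e he).length_le
  rw [I.length_flat] at hlen
  obtain ⟨t, s, htime, hexec, hout⟩ := RAMProg.runs_solver
    (I.loaded_init (hlen.trans (Nat.le_add_right _ (2 ^ (2 * r * k))))) I.valid_flat hr
    (RAMState.init_of_ne_zero _) (Nat.le_add_left _ _)
  have htime' := (htime.trans (eval_le_eval_one_mul_succ_pow _ _)).trans
    (mul_pow_le_two_pow_add_pow _ _ _ _ _)
  rw [← mul_assoc p.natDegree] at htime'
  rw [maxRLinAA_yes_iff]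
  exact ⟨fun h => ⟨t, s, htime', hexec, by rwa [if_pos h] at hout⟩,
    fun h => ⟨t, s, htime', hexec, by rwa [if_neg h] at hout⟩⟩

theorem isBigO_linear_mul_log (a b : ℕ) :
    (fun k : ℕ => ((a * k + b : ℕ) : ℝ)) =O[Filter.atTop] fun k : ℕ => (k : ℝ) * Real.log k := by
  have hid : (fun k : ℕ => (k : ℝ)) =O[Filter.atTop] fun k : ℕ => (k : ℝ) * Real.log k := by
    simpa using (Asymptotics.isBigO_refl (fun k : ℕ => (k : ℝ)) Filter.atTop).mul
      ((Real.isLittleO_const_log_atTop (c := 1)).isBigO.comp_tendsto tendsto_natCast_atTop_atTop)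
  have hconst : (fun _ : ℕ => (b : ℝ)) =O[Filter.atTop] fun k : ℕ => (k : ℝ) :=
    (Asymptotics.isLittleO_const_id_atTop (b : ℝ)).isBigO.comp_tendsto tendsto_natCast_atTop_atTop
  simpa using (hid.const_mul_left (a : ℝ)).add (hconst.trans hid)

theorem mainTheorem5_general (r : ℕ) (hr : 0 < r) :
    (maxRLinAA r).HasKernelWith (fun I : RLinSystem r => I.n) (fun k => 2 * r * k) ∧
    ∃ a b d : ℕ, (maxRLinAA r).SolvableInTime
      fun (I : RLinSystem r) k => 2 ^ (a * k + b) + I.m ^ d :=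
  ⟨hasKernelWith_two_mul_mul hr, solvableInTime_two_pow_add_pow hr⟩

theorem mainTheorem5 (r : ℕ) (hr : 2 ≤ r) :
    (∃ h : ℕ → ℕ,
      ((fun k : ℕ => (h k : ℝ)) =O[Filter.atTop] fun k : ℕ => (k : ℝ) * Real.log k) ∧
      (maxRLinAA r).HasKernelWith (fun I : RLinSystem r => I.n) h) ∧
    (∃ (h : ℕ → ℕ) (d : ℕ),
      ((fun k : ℕ => (h k : ℝ)) =O[Filter.atTop] fun k : ℕ => (k : ℝ) * Real.log k) ∧
      (maxRLinAA r).SolvableInTime (fun (I : RLinSystem r) k => 2 ^ h k + I.m ^ d)) := by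
  obtain ⟨hkernel, a, b, d, hsolve⟩ := mainTheorem5_general r (by omega)
  exact ⟨⟨_, isBigO_linear_mul_log (2 * r) 0, hkernel⟩, _, d, isBigO_linear_mul_log a b, hsolve⟩
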